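/- Let $n\ge 1$, $G=\mathrm{SL}(n+1,\mathbb R)$ with a Haar measure $dg$, $K=\mathrm{SO}(n+1,\mathbb R)$, and let $\mathfrak a$ be the space of traceless real diagonal matrices $H=\mathrm{diag}(h_1,\dots,h_{n+1})$, with simple roots $\alpha_i(H)=h_i-h_{i+1}$ $(1\le i\le n)$, closed Weyl chamber $\mathfrak a^+=\{H\in\mathfrak a:\alpha_i(H)\ge 0 \text{ for all } i\}$, sum of positive roots $2\rho(H)=\sum_{i<j}(h_i-h_j)$, and vectors $\tilde\beta_1,\dots,\tilde\beta_n\in\mathfrak a$ dual to the simple roots, $\alpha_i(\tilde\beta_j)=\delta_{ij}$. Let $\tau:G\to \mathrm{GL}(N,\mathbb R)$ be a continuous non-trivial irreducible representation with $\tau(K)\subset \mathrm{SO}(N)$ and highest weight $\lambda\in\mathfrak a^*$, and put $B_T^\tau=\{g\in G:\ \mathrm{tr}(\tau(g)^t\tau(g))^{1/2}\le T\}$. Let $\theta\in\mathfrak a^*$ be such that $\psi=2\rho-\theta$ satisfies $\psi(\tilde\beta_j)>0$ for $1\le j\le n$. Let $F:G\to\mathbb R$ be a measurable bi-$K$-invariant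 function with $F(\exp H)=P(H)e^{-\theta(H)}$ for all $H\in\mathfrak a^+$, where $P$ is a real function on $\mathfrak a^+$ whose absolute value is bounded by a polynomial in $\|H\|$. Then there are $l'\in\mathbb N$ and $C>0$ such that for every $T>1$ the function $F$ is integrable on $B_T^\tau$ and $$\int_{B_T^\tau}F(g)\,dg\ \le\ C(\log T)^{l'}\,T^{1/m_1'},\qquad m_1'=\min_{1\le j\le n}\frac{\lambda(\tilde\beta_j)}{\psi(\tilde\beta_j)}.$$ -/

import Mathlib

open MeasureTheory
open scoped Matrix

namespace SLBalls

/-- The group `SL(n+1, ℝ)`. -/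
abbrev G (n : ℕ) : Type := Matrix.SpecialLinearGroup (Fin (n + 1)) ℝ

/-- The maximal compact subgroup `K = SO(n+1, ℝ)` of `SL(n+1, ℝ)`. -/
def K (n : ℕ) : Subgroup (G n) where
  carrier := {k | (k : Matrix (Fin (n + 1)) (Fin (n + 1)) ℝ) ∈
    Matrix.specialOrthogonalGroup (Fin (n + 1)) ℝ}
  one_mem' := by
    change ((1 : G n) : Matrix (Fin (n + 1)) (Fin (n + 1)) ℝ) ∈
      Matrix.specialOrthogonalGroup (Fin (n + 1)) ℝ
    rw [Matrix.SpecialLinearGroup.coe_one]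
    exact one_mem _
  mul_mem' := by
    intro a b ha hb
    change ((a * b : G n) : Matrix (Fin (n + 1)) (Fin (n + 1)) ℝ) ∈
      Matrix.specialOrthogonalGroup (Fin (n + 1)) ℝ
    rw [Matrix.SpecialLinearGroup.coe_mul]
    exact mul_mem ha hb
  inv_mem' := by
    intro a ha
    have h := (Matrix.mem_specialOrthogonalGroup_iff.mp ha).1
    have h1 : a.1 * star a.1 = 1 := (Matrix.mem_orthogonalGroup_iff (Fin (n + 1)) ℝ).mp h
    have h4 : a.1.adjugate = star a.1 := by
      have h2 : a.1.adjugate * a.1 = 1 := by rw [Matrix.adjugate_mul, a.2, one_smul]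
      exact left_inv_eq_right_inv h2 h1
    change ((a⁻¹ : G n) : Matrix (Fin (n + 1)) (Fin (n + 1)) ℝ) ∈
      Matrix.specialOrthogonalGroup (Fin (n + 1)) ℝ
    rw [Matrix.SpecialLinearGroup.coe_inv, Matrix.mem_specialOrthogonalGroup_iff, h4]
    refine ⟨Unitary.star_mem h, ?_⟩
    rw [← h4, Matrix.det_adjugate, a.2, one_pow]

/-- The Lie algebra `𝔞` of the split Cartan subgroup `A` of positive diagonal matrices: the
traceless diagonal matrices `diag(h₀, …, hₙ)`, identified with their vectors of diagonal entries. -/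
def Cartan (n : ℕ) : Submodule ℝ (Fin (n + 1) → ℝ) where
  carrier := {h | ∑ i, h i = 0}
  zero_mem' := by simp
  add_mem' := by
    intro a b ha hb
    simp only [Set.mem_ofPred_eq, Pi.add_apply, Finset.sum_add_distrib] at *
    rw [ha, hb, add_zero]
  smul_mem' := by
    intro c a ha
    simp only [Set.mem_ofPred_eq, Pi.smul_apply, smul_eq_mul, ← Finset.mul_sum] at *
    rw [ha, mul_zero]

/-- The exponential map `𝔞 → A ⊆ SL(n+1, ℝ)`. -/
noncomputable def expA {n : ℕ} (H : Cartan n) : G n :=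
  ⟨Matrix.diagonal fun i => Real.exp (H.1 i), by
    have h : ∑ i, H.1 i = 0 := H.2
    rw [Matrix.det_diagonal, ← Real.exp_sum, h, Real.exp_zero]⟩

/-- `expA` is the matrix exponential. -/
theorem expA_eq_exp {n : ℕ} (H : Cartan n) :
    (expA H : Matrix (Fin (n + 1)) (Fin (n + 1)) ℝ) = NormedSpace.exp (Matrix.diagonal H.1) := by
  rw [Matrix.exp_diagonal, Pi.exp_def]
  simp only [expA, Real.exp_eq_exp_ℝ]

/-- The linear functional `H ↦ hᵢ - hⱼ` on `𝔞` (a root of `SL(n+1, ℝ)` when `i ≠ j`). -/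
def root (n : ℕ) (i j : Fin (n + 1)) : Module.Dual ℝ (Cartan n) where
  toFun H := H.1 i - H.1 j
  map_add' H H' := by simp only [Submodule.coe_add, Pi.add_apply]; ring
  map_smul' c H := by
    simp only [Submodule.coe_smul, Pi.smul_apply, smul_eq_mul, RingHom.id_apply]; ring

/-- The simple roots `αᵢ(H) = hᵢ - hᵢ₊₁`. -/
def simpleRoot (n : ℕ) (i : Fin n) : Module.Dual ℝ (Cartan n) := root n i.castSucc i.succ

/-- `2ρ`, the sum of the positive roots `H ↦ hᵢ - hⱼ`, `i < j`. -/
def twoRho (n : ℕ) : Module.Dual ℝ (Cartan n) :=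
  ∑ p : Fin (n + 1) × Fin (n + 1) with p.1 < p.2, root n p.1 p.2

/-- The closed Weyl chamber `𝔞⁺`, on which all simple roots are nonnegative. -/
def chamber (n : ℕ) : Set (Cartan n) := {H | ∀ i, 0 ≤ simpleRoot n i H}

/-- The vectors `β̃ⱼ ∈ 𝔞`, the basis dual to the simple roots; see `simpleRoot_dualVec`. -/
noncomputable def dualVec (n : ℕ) (j : Fin n) : Cartan n :=
  ⟨fun i => (if i ≤ j.castSucc then 1 else 0) - ((j : ℝ) + 1) / ((n : ℝ) + 1), by
    change ∑ i : Fin (n + 1),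
      ((if i ≤ j.castSucc then (1 : ℝ) else 0) - ((j : ℝ) + 1) / ((n : ℝ) + 1)) = 0
    have hc : (Finset.univ.filter fun i : Fin (n + 1) => i ≤ j.castSucc).card = (j : ℕ) + 1 := by
      have : (Finset.univ.filter fun i : Fin (n + 1) => i ≤ j.castSucc)
          = Finset.Iic j.castSucc := by ext; simp
      rw [this, Fin.card_Iic]; simp
    rw [Finset.sum_sub_distrib, Finset.sum_boole, hc]
    have : (n : ℝ) + 1 ≠ 0 := by positivity
    simp only [Finset.sum_const, Finset.card_univ, Fintype.card_fin, nsmul_eq_mul]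
    push_cast
    field_simp
    ring⟩

theorem simpleRoot_dualVec (n : ℕ) (i j : Fin n) :
    simpleRoot n i (dualVec n j) = if i = j then 1 else 0 := by
  simp only [simpleRoot, root, dualVec, LinearMap.coe_mk, AddHom.coe_mk, sub_sub_sub_cancel_right]
  simp only [Fin.le_def, Fin.val_castSucc, Fin.val_succ, Fin.ext_iff]
  split_ifs <;> first | (exfalso; omega) | norm_num

/-- The linear representation of `SL(n+1, ℝ)` on `ℝᴺ` given by `τ : SL(n+1, ℝ) → GL(N, ℝ)`. -/
noncomputable def linRep {n N : ℕ} (τ : G n →* GL (Fin N) ℝ) :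
    Representation ℝ (G n) (Fin N → ℝ) :=
  (Units.coeHom (Module.End ℝ (Fin N → ℝ))).comp
    (Matrix.GeneralLinearGroup.toLin.toMonoidHom.comp τ)

/-- `μ ∈ 𝔞*` is a weight of `τ`: some nonzero `v` satisfies `τ(exp H) v = e^{μ(H)} v` for all
`H ∈ 𝔞`. -/
def IsWeight {n N : ℕ} (τ : G n →* GL (Fin N) ℝ) (μ : Module.Dual ℝ (Cartan n)) : Prop :=
  ∃ v : Fin N → ℝ, v ≠ 0 ∧ ∀ H : Cartan n, linRep τ (expA H) v = Real.exp (μ H) • v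

/-- `lam` is the highest weight of `τ`: it is a weight of `τ`, and every weight of `τ` is obtained
from it by subtracting a sum of simple roots. -/
def IsHighestWeight {n N : ℕ} (τ : G n →* GL (Fin N) ℝ) (lam : Module.Dual ℝ (Cartan n)) : Prop :=
  IsWeight τ lam ∧
    ∀ μ, IsWeight τ μ → ∃ c : Fin n → ℕ, lam - μ = ∑ i, c i • simpleRoot n i

/-- `‖g‖_τ = (tr(τ(g)ᵗ τ(g)))^{1/2}`. -/
noncomputable def normTau {n N : ℕ} (τ : G n →* GL (Fin N) ℝ) (g : G n) : ℝ :=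
  Real.sqrt (((τ g : Matrix (Fin N) (Fin N) ℝ)ᵀ * (τ g : Matrix (Fin N) (Fin N) ℝ)).trace)

/-- The norm ball `B_T^τ`. -/
def ball {n N : ℕ} (τ : G n →* GL (Fin N) ℝ) (T : ℝ) : Set (G n) := {g | normTau τ g ≤ T}

/-- `m₁' = minⱼ lam(β̃ⱼ) / ψ(β̃ⱼ)` (a minimum over a finite set, nonempty for `1 ≤ n`). -/
noncomputable def mOnePrime (n : ℕ) (lam ψ : Module.Dual ℝ (Cartan n)) : ℝ :=
  ⨅ j : Fin n, lam (dualVec n j) / ψ (dualVec n j)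

end SLBalls

/-!
The integral of `F` over the ball is estimated by cutting the Weyl chamber into unit cells.

Write `H = ∑ tⱼ β̃ⱼ` and collect the `K exp(H) K` with `⌊tⱼ⌋ = mⱼ` in a compact shell. By the Cartan
decomposition (`exists_eq_mul_expA_mul`) the shells cover `G`, and `|F|` is at most
`A (1 + ∑ mⱼ)^d e^{-θ(m)}` on the shell of `m`, where `m` also stands for `∑ mⱼ β̃ⱼ`.

The shell of `m` has volume at most `C e^{2ρ(m)}` (`exists_measure_K_mul_expA_mul_le`). This needs no
Jacobian. Near the identity an element of `K` is a product `x y` of a unipotent lower and an upper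
triangular matrix, both bounded; with `a = exp(H)`, the conjugate `a⁻¹ y a` stays bounded, and
`a⁻¹ x a` has entries at most `e^{hⱼ - hᵢ}` at `(i, j)`, `j < i`. Modulo the integral unipotent
matrices it can be brought into a fixed compact set, and the number of integral matrices needed is at
most a constant times `∏_{j < i} e^{hⱼ - hᵢ} = e^{2ρ(H)}`. So `K a Ω` is covered by that many
translates of one compact set (`exists_covering`).

A weight vector for the highest weight gives `e^{λ(H)} ≤ ‖exp(H)‖_τ`, so only the shells with
`λ(m) ≤ log T` meet the ball. There `ψ(m) ≤ λ(m) / m₁' ≤ log T / m₁'`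
(`apply_latticePoint_le`), and there are at most `(1 + log T / minⱼ λ(β̃ⱼ))^n` of them, which yields
the bound with `1 + log T / minⱼ λ(β̃ⱼ)` in place of `log T`. The two are comparable unless `T` is
close to `1`, and for `T < √2` the ball is empty: `SL(n+1, ℝ)` has no nontrivial homomorphism to a
commutative group (`hom_comm_eq_one`), so `N ≥ 2` and `det τ(g) = 1`, whence `‖g‖_τ² ≥ N`.

All this uses `λ(β̃ⱼ) > 0` (`IsHighestWeight.apply_dualVec_pos`). The Weyl group permutes the weights,
so `λ` is dominant, and if it vanished on some `β̃ⱼ`, it would be zero. Then a highest weight vector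
`v` would be fixed by `exp(𝔞)`, and its derivatives along the root subgroups would vanish, since no
root is a weight. So `v` would be fixed by all transvections, that is by the whole group, and `τ`
would be trivial by irreducibility.
-/

namespace SLBalls

/-! ### Generation by transvections -/

/-- The diagonal matrix with entries `a`, `a⁻¹` in positions `i`, `j` as a product of six
transvections. -/
theorem diag2n_eq_prod_transvection {ι : Type*} [Fintype ι] [DecidableEq ι] {i j : ι}
    (hij : i ≠ j) (a : ℝ) (ha : a ≠ 0) :
    Matrix.SpecialLinearGroup.diag2n hij a ha =
      Matrix.SpecialLinearGroup.transvection hij a *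
      Matrix.SpecialLinearGroup.transvection hij.symm (-a⁻¹) *
      Matrix.SpecialLinearGroup.transvection hij a *
      Matrix.SpecialLinearGroup.transvection hij (-1) *
      Matrix.SpecialLinearGroup.transvection hij.symm 1 *
      Matrix.SpecialLinearGroup.transvection hij (-1) := by
  apply Subtype.ext
  simp only [Matrix.SpecialLinearGroup.coe_mul, Matrix.SpecialLinearGroup.transvection_coe,
    Matrix.SpecialLinearGroup.diag2n_coe, mul_add, add_mul, mul_one, one_mul,
    Matrix.single_mul_single_same, Matrix.single_mul_single_of_ne _ _ _ _ hij,
    Matrix.single_mul_single_of_ne _ _ _ _ hij.symm, add_zero]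
  ext k l
  simp only [Matrix.add_apply, Matrix.diagonal_apply, Matrix.one_apply, Matrix.single_apply]
  by_cases hki : k = i <;> by_cases hkj : k = j <;> by_cases hli : l = i <;>
    by_cases hlj : l = j <;> simp_all [eq_comm]

/-- `SL(n+1, ℝ)` is generated by transvections. -/
theorem transvection_induction {n : ℕ} (hn : 1 ≤ n) (Q : G n → Prop)
    (ht : ∀ (i j : Fin (n + 1)) (hij : i ≠ j) (s : ℝ),
      Q (Matrix.SpecialLinearGroup.transvection hij s))
    (hmul : ∀ A B, Q A → Q B → Q (A * B)) (g : G n) : Q g := by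
  have : Nontrivial (Fin (n + 1)) := Fin.nontrivial_iff_two_le.2 (by omega)
  refine Matrix.SpecialLinearGroup.diagonal_transvection_induction' Q g ?_ ht hmul
  intro i j hij c hc
  rw [diag2n_eq_prod_transvection]
  exact hmul _ _ (hmul _ _ (hmul _ _ (hmul _ _ (hmul _ _ (ht _ _ _ _) (ht _ _ _ _)) (ht _ _ _ _))
    (ht _ _ _ _)) (ht _ _ _ _)) (ht _ _ _ _)

theorem coe_expA {n : ℕ} (H : Cartan n) : (expA H : Matrix (Fin (n + 1)) (Fin (n + 1)) ℝ) =
    Matrix.diagonal fun i => Real.exp (H.1 i) := rfl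

theorem expA_mul_transvection {n : ℕ} (H : Cartan n) {i j : Fin (n + 1)} (hij : i ≠ j) (s : ℝ) :
    expA H * Matrix.SpecialLinearGroup.transvection hij s =
      Matrix.SpecialLinearGroup.transvection hij (Real.exp (root n i j H) * s) * expA H := by
  apply Subtype.ext
  rw [Matrix.SpecialLinearGroup.coe_mul, Matrix.SpecialLinearGroup.coe_mul]
  ext k l
  simp only [Matrix.SpecialLinearGroup.transvection_coe, coe_expA,
    mul_add, add_mul, Matrix.add_apply, Matrix.diagonal_mul, Matrix.mul_diagonal,
    Matrix.single_apply]
  split_ifs with h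
  · obtain ⟨rfl, rfl⟩ := h
    have : Real.exp (root n i j H) = Real.exp (H.1 i) / Real.exp (H.1 j) := by
      rw [← Real.exp_sub]; rfl
    rw [this, Matrix.one_apply_ne hij]
    field_simp
    ring
  · by_cases hkl : k = l
    · simp [hkl, mul_comm]
    · simp [hkl]

theorem expA_add {n : ℕ} (H H' : Cartan n) : expA (H + H') = expA H * expA H' := by
  apply Subtype.ext
  rw [Matrix.SpecialLinearGroup.coe_mul]
  simp [coe_expA, Matrix.diagonal_mul_diagonal, Real.exp_add]

theorem expA_zero {n : ℕ} : expA (0 : Cartan n) = 1 := by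
  apply Subtype.ext
  simp [expA]

/-- The coroot direction `eₚ - e_q ∈ 𝔞`. -/
def diffVec (n : ℕ) (p q : Fin (n + 1)) : Cartan n :=
  ⟨Pi.single p 1 - Pi.single q 1, by
    change ∑ i, (Pi.single p 1 - Pi.single q 1 : Fin (n + 1) → ℝ) i = 0
    simp⟩

theorem root_diffVec {n : ℕ} {p q : Fin (n + 1)} (h : p ≠ q) : root n p q (diffVec n p q) = 2 := by
  simp [root, diffVec, h, h.symm]
  norm_num

/-- Every homomorphism from `SL(n+1, ℝ)` to a commutative group is trivial: conjugation by a
diagonal matrix turns a transvection into its square. -/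
theorem hom_comm_eq_one {n : ℕ} (hn : 1 ≤ n) {M : Type*} [CommGroup M] (χ : G n →* M) (g : G n) :
    χ g = 1 := by
  refine transvection_induction hn (fun g => χ g = 1) ?_ ?_ g
  · intro i j hij s
    have h := congrArg χ (expA_mul_transvection ((Real.log 2 / 2) • diffVec n i j) hij s)
    rw [map_smul, root_diffVec hij, smul_eq_mul, div_mul_cancel₀ _ (two_ne_zero),
      Real.exp_log two_pos, two_mul, Matrix.SpecialLinearGroup.transvection_add, map_mul, map_mul,
      map_mul, mul_comm] at h
    have h2 := mul_right_cancel h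
    exact (left_eq_mul.mp h2)
  · intro A B hA hB
    rw [map_mul, hA, hB, one_mul]

theorem det_eq_one {n N : ℕ} (hn : 1 ≤ n) (τ : G n →* GL (Fin N) ℝ) (g : G n) :
    (τ g : Matrix (Fin N) (Fin N) ℝ).det = 1 := by
  have := hom_comm_eq_one hn (Matrix.GeneralLinearGroup.det.comp τ) g
  simpa using congrArg Units.val this

theorem two_le_of_ne_one {n N : ℕ} (hn : 1 ≤ n) (τ : G n →* GL (Fin N) ℝ) (hτ : τ ≠ 1) :
    2 ≤ N := by
  by_contra hN
  apply hτ
  ext g i j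
  have h := det_eq_one hn τ g
  obtain rfl | rfl : N = 0 ∨ N = 1 := by omega
  · exact i.elim0
  · rw [Matrix.det_fin_one] at h
    fin_cases i; fin_cases j
    simpa using h

/-! ### The norm -/

/-- The inequality of arithmetic and geometric means for the eigenvalues of `Aᵀ A`, in the form
`∑ log x ≤ ∑ (x - 1)`. -/
theorem nat_le_trace_transpose_mul_self {N : ℕ} (A : Matrix (Fin N) (Fin N) ℝ) (hA : A.det = 1) :
    (N : ℝ) ≤ (Aᵀ * A).trace := by
  have hpd : (Aᵀ * A).PosDef := by
    have hu : IsUnit A := (Matrix.isUnit_iff_isUnit_det A).2 (by rw [hA]; exact isUnit_one)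
    have := (Matrix.PosDef.one (n := Fin N) (R := ℝ)).conjTranspose_mul_mul_same
      (B := A) (Matrix.mulVec_injective_of_isUnit hu)
    simpa using this
  have hprod : ∏ i, hpd.1.eigenvalues i = 1 := by
    have := hpd.1.det_eq_prod_eigenvalues
    simpa [hA] using this.symm
  have htr : (Aᵀ * A).trace = ∑ i, hpd.1.eigenvalues i := by
    simpa using hpd.1.trace_eq_sum_eigenvalues
  have hlog : ∑ i, Real.log (hpd.1.eigenvalues i) = 0 := by
    rw [← Real.log_prod (fun i _ => (hpd.eigenvalues_pos i).ne'), hprod, Real.log_one]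
  have := Finset.sum_le_sum (fun i (_ : i ∈ Finset.univ) =>
    Real.log_le_sub_one_of_pos (hpd.eigenvalues_pos i))
  rw [hlog, Finset.sum_sub_distrib] at this
  simp at this
  linarith

theorem sqrt_two_le_normTau {n N : ℕ} (hn : 1 ≤ n) (τ : G n →* GL (Fin N) ℝ) (hτ : τ ≠ 1)
    (g : G n) : Real.sqrt 2 ≤ normTau τ g := by
  refine Real.sqrt_le_sqrt (le_trans ?_ (nat_le_trace_transpose_mul_self _ (det_eq_one hn τ g)))
  exact_mod_cast two_le_of_ne_one hn τ hτ

theorem normTau_mul_mul {n N : ℕ} {τ : G n →* GL (Fin N) ℝ}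
    (hτK : ∀ k ∈ K n,
      (τ k : Matrix (Fin N) (Fin N) ℝ) ∈ Matrix.specialOrthogonalGroup (Fin N) ℝ)
    {k₁ k₂ : G n} (h₁ : k₁ ∈ K n) (h₂ : k₂ ∈ K n) (g : G n) :
    normTau τ (k₁ * g * k₂) = normTau τ g := by
  have e1 := (Matrix.mem_orthogonalGroup_iff' (Fin N) ℝ).1
    (Matrix.mem_specialOrthogonalGroup_iff.1 (hτK k₁ h₁)).1
  have e2 := (Matrix.mem_orthogonalGroup_iff (Fin N) ℝ).1
    (Matrix.mem_specialOrthogonalGroup_iff.1 (hτK k₂ h₂)).1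
  unfold normTau
  congr 1
  simp only [map_mul, Units.val_mul, Matrix.transpose_mul]
  set A : Matrix (Fin N) (Fin N) ℝ := (τ k₁ : Matrix (Fin N) (Fin N) ℝ)
  set B : Matrix (Fin N) (Fin N) ℝ := (τ g : Matrix (Fin N) (Fin N) ℝ)
  set C : Matrix (Fin N) (Fin N) ℝ := (τ k₂ : Matrix (Fin N) (Fin N) ℝ)
  calc (Cᵀ * (Bᵀ * Aᵀ) * (A * B * C)).trace = (Cᵀ * (Bᵀ * (Aᵀ * A) * B * C)).trace := by
        simp only [Matrix.mul_assoc]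
    _ = (Bᵀ * B * (C * Cᵀ)).trace := by
        rw [e1, Matrix.mul_one, Matrix.trace_mul_comm, Matrix.mul_assoc]
    _ = _ := by rw [e2, Matrix.mul_one]

theorem linRep_apply {n N : ℕ} (τ : G n →* GL (Fin N) ℝ) (g : G n) (v : Fin N → ℝ) :
    linRep τ g v = (τ g : Matrix (Fin N) (Fin N) ℝ) *ᵥ v := rfl

/-- The Frobenius norm of a matrix is at least the modulus of any real eigenvalue. -/
theorem sq_le_trace_of_mulVec_eq_smul {N : ℕ} (A : Matrix (Fin N) (Fin N) ℝ) {v : Fin N → ℝ}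
    (hv : v ≠ 0) {c : ℝ} (h : A *ᵥ v = c • v) : c ^ 2 ≤ (Aᵀ * A).trace := by
  have hpos : 0 < ∑ i, v i ^ 2 := by
    obtain ⟨i, hi⟩ := Function.ne_iff.1 hv
    exact Finset.sum_pos' (fun _ _ => sq_nonneg _) ⟨i, Finset.mem_univ _, by
      have : v i ≠ 0 := hi
      positivity⟩
  have htr : (Aᵀ * A).trace = ∑ i, ∑ j, A i j ^ 2 := by
    rw [Finset.sum_comm]
    simp [Matrix.trace, Matrix.mul_apply, sq]
  have key : c ^ 2 * ∑ i, v i ^ 2 ≤ (Aᵀ * A).trace * ∑ i, v i ^ 2 := by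
    rw [htr, Finset.mul_sum, Finset.sum_mul]
    refine Finset.sum_le_sum fun i _ => ?_
    have hi : ∑ j, A i j * v j = c * v i := by
      simpa [Matrix.mulVec, dotProduct] using congrFun h i
    rw [← mul_pow, ← hi]
    exact Finset.sum_mul_sq_le_sq_mul_sq _ _ _
  exact le_of_mul_le_mul_right key hpos

/-- As `τ(K)` may preserve several inner products, `τ(exp H)` need not be symmetric, but only the
lower bound of its norm by an eigenvalue is needed. -/
theorem exp_le_normTau {n N : ℕ} {τ : G n →* GL (Fin N) ℝ} {μ : Module.Dual ℝ (Cartan n)}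
    (hμ : IsWeight τ μ) (H : Cartan n) : Real.exp (μ H) ≤ normTau τ (expA H) := by
  obtain ⟨v, hv, h⟩ := hμ
  exact Real.le_sqrt_of_sq_le (sq_le_trace_of_mulVec_eq_smul _ hv (h H))

/-! ### Weights and the Weyl group -/

/-- The action of a permutation on `𝔞` by permuting the diagonal entries. -/
def permCartan (n : ℕ) (σ : Equiv.Perm (Fin (n + 1))) : Cartan n →ₗ[ℝ] Cartan n where
  toFun H := ⟨fun i => H.1 (σ i), by
    change ∑ i, H.1 (σ i) = 0
    rw [Equiv.sum_comp σ]
    exact H.2⟩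
  map_add' _ _ := rfl
  map_smul' _ _ := rfl

/-- A representative in `SL(n+1, ℝ)` of a Weyl group element: the permutation matrix with its first
row multiplied by the sign of the permutation, which makes the determinant `1`. -/
noncomputable def signedPerm (n : ℕ) (σ : Equiv.Perm (Fin (n + 1))) : G n :=
  ⟨Matrix.diagonal (Function.update 1 0 ((Equiv.Perm.sign σ : ℤ) : ℝ)) * σ.permMatrix ℝ, by
    rw [Matrix.det_mul, Matrix.det_diagonal, Matrix.det_permutation,
      Finset.prod_update_of_mem (Finset.mem_univ _)]
    simp only [Pi.one_apply, Finset.prod_const_one, mul_one]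
    norm_cast
    simp⟩

theorem signedPerm_mul_expA {n : ℕ} (σ : Equiv.Perm (Fin (n + 1))) (H : Cartan n) :
    signedPerm n σ * expA H = expA (permCartan n σ H) * signedPerm n σ := by
  apply Subtype.ext
  rw [Matrix.SpecialLinearGroup.coe_mul, Matrix.SpecialLinearGroup.coe_mul]
  ext i j
  simp only [coe_expA, signedPerm, Matrix.mul_diagonal, Matrix.diagonal_mul, permCartan,
    Equiv.Perm.permMatrix, PEquiv.toMatrix_apply, Equiv.toPEquiv_apply, LinearMap.coe_mk,
    AddHom.coe_mk, Option.mem_def, Option.some.injEq]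
  split_ifs with h
  · rw [h]; ring
  · simp

theorem IsWeight.comp_permCartan {n N : ℕ} {τ : G n →* GL (Fin N) ℝ}
    {μ : Module.Dual ℝ (Cartan n)} (h : IsWeight τ μ) (σ : Equiv.Perm (Fin (n + 1))) :
    IsWeight τ (μ ∘ₗ permCartan n σ) := by
  obtain ⟨v, hv, hw⟩ := h
  refine ⟨linRep τ (signedPerm n σ⁻¹) v, fun h0 => hv ?_, fun H => ?_⟩
  · have := congrArg (linRep τ (signedPerm n σ⁻¹)⁻¹) h0
    rwa [map_zero, ← Module.End.mul_apply, ← map_mul, inv_mul_cancel, map_one,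
      Module.End.one_apply] at this
  · have hH : permCartan n σ⁻¹ (permCartan n σ H) = H := by
      apply Subtype.ext
      funext i
      simp [permCartan]
    have h1 := signedPerm_mul_expA σ⁻¹ (permCartan n σ H)
    rw [hH] at h1
    rw [← Module.End.mul_apply, ← map_mul, ← h1, map_mul, Module.End.mul_apply, hw, map_smul]
    rfl

/-- The defining property of the highest weight, evaluated on the dual basis of the simple
roots. -/
theorem IsHighestWeight.apply_dualVec_le {n N : ℕ} {τ : G n →* GL (Fin N) ℝ}
    {lam μ : Module.Dual ℝ (Cartan n)} (h : IsHighestWeight τ lam) (hμ : IsWeight τ μ)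
    (j : Fin n) : μ (dualVec n j) ≤ lam (dualVec n j) := by
  obtain ⟨c, hc⟩ := h.2 μ hμ
  have := congrArg (fun f : Module.Dual ℝ (Cartan n) => f (dualVec n j)) hc
  simp only [LinearMap.sub_apply, LinearMap.sum_apply, LinearMap.smul_apply,
    simpleRoot_dualVec] at this
  simp only [smul_ite, nsmul_eq_mul, mul_one, smul_zero, Finset.sum_ite_eq', Finset.mem_univ,
    if_true] at this
  have : (0 : ℝ) ≤ c j := Nat.cast_nonneg _
  linarith

theorem dualVec_sub_permCartan_swap {n : ℕ} {p q : Fin (n + 1)} {j : Fin n}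
    (hp : p ≤ j.castSucc) (hq : j.castSucc < q) :
    dualVec n j - permCartan n (Equiv.swap p q) (dualVec n j) = diffVec n p q := by
  have hpq : p ≠ q := (hp.trans_lt hq).ne
  apply Subtype.ext
  funext i
  simp only [Submodule.coe_sub, Pi.sub_apply, dualVec, permCartan, diffVec, LinearMap.coe_mk,
    AddHom.coe_mk]
  rcases eq_or_ne i p with rfl | hip
  · simp [hp, hq, hpq]
  · rcases eq_or_ne i q with rfl | hiq
    · simp [hp, hq, hpq.symm]
    · simp [Equiv.swap_apply_of_ne_of_ne hip hiq, hip, hiq]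

/-- The highest weight is dominant. -/
theorem IsHighestWeight.apply_diffVec_nonneg {n N : ℕ} {τ : G n →* GL (Fin N) ℝ}
    {lam : Module.Dual ℝ (Cartan n)} (h : IsHighestWeight τ lam) {p q : Fin (n + 1)}
    (hpq : p < q) : 0 ≤ lam (diffVec n p q) := by
  have hpn : (p : ℕ) < n := by have := q.2; have : (p : ℕ) < q := hpq; omega
  have := h.apply_dualVec_le (h.1.comp_permCartan (Equiv.swap p q)) ⟨p, hpn⟩
  -- the difference of a highest weight and its reflection, evaluated on `β̃ₚ`
  rw [← dualVec_sub_permCartan_swap (j := ⟨p, hpn⟩) (p := p) (q := q) (le_of_eq (by ext; simp))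
    hpq, map_sub]
  simpa using this

/-- The fundamental coweights in terms of coroots. -/
theorem smul_dualVec_eq_sum {n : ℕ} (j : Fin n) :
    ((n : ℝ) + 1) • dualVec n j =
      ∑ p ∈ Finset.Iic j.castSucc, ∑ q ∈ Finset.Ioi j.castSucc, diffVec n p q := by
  apply Subtype.ext
  funext i
  have hn : (n : ℝ) + 1 ≠ 0 := by positivity
  have hj : ((j.castSucc : Fin (n + 1)) : ℕ) = j := rfl
  have hjn : (j : ℕ) ≤ n := j.2.le
  simp only [Submodule.coe_smul, Submodule.coe_sum, Finset.sum_apply, Pi.smul_apply, smul_eq_mul,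
    dualVec, diffVec, Pi.sub_apply, Finset.sum_sub_distrib, Finset.sum_const, Fin.card_Iic,
    Fin.card_Ioi, hj, Pi.single_apply, nsmul_eq_mul, Pi.mul_apply, Pi.natCast_apply,
    mul_ite, mul_one, mul_zero, Finset.sum_ite_eq, Finset.mem_Iic, Finset.mem_Ioi]
  by_cases hi : i ≤ j.castSucc
  · have : n + 1 - 1 - (j : ℕ) = n - j := by omega
    simp only [hi, if_true, not_lt.2 hi, if_false, this, Nat.cast_sub hjn]
    field_simp
    ring
  · simp only [hi, if_false, not_le.1 hi, if_true]
    push_cast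
    field_simp
    ring

/-! ### One-parameter groups -/

/-- A continuous one-parameter semigroup in a Banach algebra is differentiable at `0`:
averaging over a short interval gives an invertible element `F`, and `U t * F` is the integral of
`U` over a translated interval. -/
theorem exists_hasDerivAt_of_continuous_of_map_add {A : Type*} [NormedRing A] [NormedAlgebra ℝ A]
    [CompleteSpace A] {U : ℝ → A} (hU : Continuous U) (h0 : U 0 = 1)
    (hadd : ∀ s t, U (s + t) = U s * U t) : ∃ X, HasDerivAt U X 0 := by
  have hder : HasDerivAt (fun ε => ∫ s in (0 : ℝ)..ε, U s) (U 0) 0 :=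
    intervalIntegral.integral_hasDerivAt_right (hU.intervalIntegrable _ _)
      hU.stronglyMeasurable.stronglyMeasurableAtFilter hU.continuousAt
  have hlim := hder.tendsto_slope_zero_right
  simp only [zero_add, intervalIntegral.integral_same, sub_zero, h0] at hlim
  have hev := hlim.eventually (Units.isOpen.mem_nhds (isUnit_one (M := A)))
  obtain ⟨ε, hε, hεpos⟩ := (hev.and self_mem_nhdsWithin).exists
  have hεpos : (0 : ℝ) < ε := hεpos
  have hF : IsUnit (∫ s in (0 : ℝ)..ε, U s) := by
    have : (∫ s in (0 : ℝ)..ε, U s) = algebraMap ℝ A ε * (ε⁻¹ • ∫ s in (0 : ℝ)..ε, U s) := by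
      rw [← Algebra.smul_def, smul_smul, mul_inv_cancel₀ hεpos.ne', one_smul]
    rw [this]
    exact ((isUnit_iff_ne_zero.2 hεpos.ne').map (algebraMap ℝ A)).mul hε
  obtain ⟨u, hu⟩ := hF
  have hUt : ∀ t, U t =
      ((∫ s in (0 : ℝ)..(t + ε), U s) - ∫ s in (0 : ℝ)..t, U s) * (↑u⁻¹ : A) := by
    intro t
    have h1 : U t * (u : A) = ∫ s in t..(t + ε), U s := by
      rw [hu, ← ContinuousLinearMap.mul_apply' ℝ A (U t),
        ← ContinuousLinearMap.intervalIntegral_comp_comm _ (hU.intervalIntegrable _ _)]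
      simp only [ContinuousLinearMap.mul_apply', ← hadd]
      rw [intervalIntegral.integral_comp_add_left]
      simp
    rw [intervalIntegral.integral_interval_sub_left (hU.intervalIntegrable _ _)
      (hU.intervalIntegrable _ _), ← h1, mul_assoc, Units.mul_inv, mul_one]
  have hd1 : HasDerivAt (fun t => ∫ s in (0 : ℝ)..(t + ε), U s) (U (0 + ε)) 0 := by
    have : HasDerivAt (fun b => ∫ s in (0 : ℝ)..b, U s) (U (0 + ε)) (0 + ε) :=
      intervalIntegral.integral_hasDerivAt_right (hU.intervalIntegrable _ _)
        hU.stronglyMeasurable.stronglyMeasurableAtFilter hU.continuousAt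
    exact this.comp_add_const 0 ε
  refine ⟨_, ((hd1.sub hder).mul_const (↑u⁻¹ : A)).congr_of_eventuallyEq
    (Filter.Eventually.of_forall hUt)⟩

section

attribute [local instance] Matrix.linftyOpNormedRing Matrix.linftyOpNormedAlgebra

/-- Let `v` have weight `0`. The derivative `X v` of `s ↦ τ(1 + s E_{ij}) v` at `s = 0` is zero or a
vector of weight `α_{ij}`, and if it is zero, then `v` is fixed by all `τ(1 + s E_{ij})`. -/
theorem transvection_fixed_or_isWeight_root {n N : ℕ} {τ : G n →* GL (Fin N) ℝ}
    (hτ : Continuous τ) {v : Fin N → ℝ} (hv : ∀ H, linRep τ (expA H) v = v)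
    {i j : Fin (n + 1)} (hij : i ≠ j) :
    (∀ s, linRep τ (Matrix.SpecialLinearGroup.transvection hij s) v = v) ∨
      IsWeight τ (root n i j) := by
  set U : ℝ → Matrix (Fin N) (Fin N) ℝ :=
    fun s => (τ (Matrix.SpecialLinearGroup.transvection hij s) : Matrix (Fin N) (Fin N) ℝ)
    with hUdef
  have hUadd : ∀ s t, U (s + t) = U s * U t := fun s t => by
    simp [hUdef, Matrix.SpecialLinearGroup.transvection_add]
  have hU0 : U 0 = 1 := by simp [hUdef]
  have hUc : Continuous U := by
    refine Units.continuous_val.comp (hτ.comp (continuous_induced_rng.2 ?_))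
    change Continuous fun s : ℝ => (1 : Matrix (Fin (n + 1)) (Fin (n + 1)) ℝ) + Matrix.single i j s
    refine continuous_const.add (continuous_matrix fun a b => ?_)
    simp only [Matrix.single_apply]
    split_ifs <;> fun_prop
  obtain ⟨X, hX⟩ := exists_hasDerivAt_of_continuous_of_map_add hUc hU0 hUadd
  have happ : ∀ (w : Fin N → ℝ) {f : ℝ → Matrix (Fin N) (Fin N) ℝ} {f' s},
      HasDerivAt f f' s → HasDerivAt (fun s => f s *ᵥ w) (f' *ᵥ w) s := by
    intro w f f' s hf
    exact ((LinearMap.toContinuousLinearMap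
      ((Matrix.mulVecBilin ℝ ℝ).flip w)).hasFDerivAt.comp_hasDerivAt s hf)
  have hXs : ∀ s, HasDerivAt U (U s * X) s := by
    intro s
    have h1 : HasDerivAt (fun t => U s * U (t - s)) (U s * X) s := by
      have h2 : HasDerivAt U X (s - s) := by rwa [sub_self]
      exact (h2.comp_sub_const s s).const_mul (U s)
    refine h1.congr_of_eventuallyEq (Filter.Eventually.of_forall fun t => ?_)
    change U t = U s * U (t - s)
    rw [← hUadd, add_sub_cancel]
  by_cases hXv : X *ᵥ v = 0
  · left
    intro s
    have hd : ∀ s, HasDerivAt (fun s => U s *ᵥ v) 0 s := by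
      intro s
      have := happ v (hXs s)
      rwa [← Matrix.mulVec_mulVec, hXv, Matrix.mulVec_zero] at this
    have := is_const_of_deriv_eq_zero (fun s => (hd s).differentiableAt) (fun s => (hd s).deriv) s 0
    simp only [hU0, Matrix.one_mulVec] at this
    exact this
  · right
    refine ⟨X *ᵥ v, hXv, fun H => ?_⟩
    set c := Real.exp (root n i j H)
    set B : Matrix (Fin N) (Fin N) ℝ := (τ (expA H) : Matrix (Fin N) (Fin N) ℝ) with hB
    have hconj : ∀ s, B *ᵥ (U s *ᵥ v) = U (c * s) *ᵥ v := by
      intro s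
      have h1 := congrArg (fun g => linRep τ g v) (expA_mul_transvection H hij s)
      simp only [map_mul, Module.End.mul_apply, hv] at h1
      exact h1
    have hl : HasDerivAt (fun s => B *ᵥ (U s *ᵥ v)) (B *ᵥ (X *ᵥ v)) 0 := by
      have := happ v (hX.const_mul B)
      simpa [Matrix.mulVec_mulVec] using this
    have hr : HasDerivAt (fun s => U (c * s) *ᵥ v) (c • (X *ᵥ v)) 0 := by
      have h2 : HasDerivAt U X (c * 0) := by rwa [mul_zero]
      have h3 := happ v (h2.scomp (0 : ℝ) ((hasDerivAt_id (0 : ℝ)).const_mul c))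
      simpa [Matrix.smul_mulVec] using h3
    simp only [hconj] at hl
    exact hl.unique hr

end

theorem root_dualVec_eq_one {n : ℕ} {i j : Fin (n + 1)} (hij : i < j) (hi : (i : ℕ) < n) :
    root n i j (dualVec n ⟨i, hi⟩) = 1 := by
  have : ¬ j ≤ (⟨i, hi⟩ : Fin n).castSucc := not_le.2 hij
  have h2 : i ≤ (⟨i, hi⟩ : Fin n).castSucc := le_refl i
  simp only [root, dualVec, LinearMap.coe_mk, AddHom.coe_mk, this, h2, if_true, if_false]
  ring

/-- The highest weight of a nontrivial irreducible representation is nonzero. -/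
theorem IsHighestWeight.ne_zero {n N : ℕ} (hn : 1 ≤ n) {τ : G n →* GL (Fin N) ℝ}
    (hτ : Continuous τ) (hτnontriv : τ ≠ 1) (hτirr : (linRep τ).IsIrreducible)
    {lam : Module.Dual ℝ (Cartan n)} (h : IsHighestWeight τ lam) : lam ≠ 0 := by
  rintro rfl
  have hnoroot : ∀ i j : Fin (n + 1), i < j → ¬ IsWeight τ (root n i j) := by
    intro i j hij hw
    have hi : (i : ℕ) < n := by have := j.2; have : (i : ℕ) < j := hij; omega
    have := h.apply_dualVec_le hw ⟨i, hi⟩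
    rw [root_dualVec_eq_one hij hi] at this
    simp at this
    linarith
  -- a negative root is the reflection of a positive one
  have hnoroot' : ∀ i j : Fin (n + 1), i ≠ j → ¬ IsWeight τ (root n i j) := by
    intro i j hij hw
    rcases lt_or_gt_of_ne hij with h1 | h1
    · exact hnoroot i j h1 hw
    · refine hnoroot j i h1 ?_
      convert hw.comp_permCartan (Equiv.swap i j) using 1
      ext H
      simp [root, permCartan]
  obtain ⟨⟨v, hv, hvA⟩, -⟩ := h
  have hvA' : ∀ H, linRep τ (expA H) v = v := fun H => by simpa using hvA H
  have hfix : ∀ g, linRep τ g v = v := by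
    refine transvection_induction hn _ ?_ ?_
    · intro i j hij s
      exact (transvection_fixed_or_isWeight_root hτ hvA' hij).resolve_right (hnoroot' i j hij) s
    · intro A B hA hB
      rw [map_mul, Module.End.mul_apply, hB, hA]
  let S : Subrepresentation (linRep τ) :=
    ⟨Submodule.span ℝ {v}, fun g w hw => by
      obtain ⟨c, rfl⟩ := Submodule.mem_span_singleton.1 hw
      rw [map_smul, hfix g]
      exact hw⟩
  have hS : S = ⊤ := by
    rcases eq_bot_or_eq_top S with hb | ht
    · exfalso
      have hmem : v ∈ S.toSubmodule := Submodule.mem_span_singleton_self v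
      rw [hb] at hmem
      exact hv hmem
    · exact ht
  apply hτnontriv
  ext g : 1
  apply Units.ext
  have hall : ∀ w : Fin N → ℝ, (τ g : Matrix (Fin N) (Fin N) ℝ) *ᵥ w = w := by
    intro w
    have hw : w ∈ S.toSubmodule := by rw [hS]; exact Submodule.mem_top
    obtain ⟨c, rfl⟩ := Submodule.mem_span_singleton.1 hw
    rw [Matrix.mulVec_smul, ← linRep_apply, hfix g]
  exact Matrix.ext_of_mulVec_single fun i => (hall _).trans (Matrix.one_mulVec _).symm

theorem eq_sum_simpleRoot_smul_dualVec {n : ℕ} (H : Cartan n) :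
    H = ∑ j, simpleRoot n j H • dualVec n j := by
  set D := H - ∑ j, simpleRoot n j H • dualVec n j with hD
  have hzero : ∀ i, simpleRoot n i D = 0 := by
    intro i
    simp [hD, map_sub, map_sum, simpleRoot_dualVec]
  have hconst : ∀ i : Fin (n + 1), D.1 i = D.1 0 := by
    intro i
    induction i using Fin.induction with
    | zero => rfl
    | succ i ih =>
      have : D.1 i.castSucc - D.1 i.succ = 0 := hzero i
      linarith
  have hsum : ∑ i, D.1 i = 0 := D.2
  simp only [hconst] at hsum
  have h0 : D.1 0 = 0 := by
    simp only [Finset.sum_const, Finset.card_univ, Fintype.card_fin, nsmul_eq_mul] at hsum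
    have : ((n + 1 : ℕ) : ℝ) ≠ 0 := by positivity
    exact (mul_eq_zero.1 hsum).resolve_left this
  have : D = 0 := Subtype.ext (funext fun i => by rw [hconst, h0]; rfl)
  exact sub_eq_zero.1 this

/-- The highest weight of a nontrivial irreducible representation is positive on the fundamental
coweights: a dominant functional vanishing on `β̃ⱼ` vanishes on all coroots. -/
theorem IsHighestWeight.apply_dualVec_pos {n N : ℕ} (hn : 1 ≤ n) {τ : G n →* GL (Fin N) ℝ}
    (hτ : Continuous τ) (hτnontriv : τ ≠ 1) (hτirr : (linRep τ).IsIrreducible)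
    {lam : Module.Dual ℝ (Cartan n)} (h : IsHighestWeight τ lam) (j : Fin n) :
    0 < lam (dualVec n j) := by
  have hn1 : (0 : ℝ) < (n : ℝ) + 1 := by positivity
  have key : ∀ k : Fin n, ((n : ℝ) + 1) * lam (dualVec n k) =
      ∑ p ∈ Finset.Iic k.castSucc, ∑ q ∈ Finset.Ioi k.castSucc, lam (diffVec n p q) := by
    intro k
    rw [← smul_eq_mul, ← map_smul, smul_dualVec_eq_sum]
    simp only [map_sum]
  have hlt : ∀ k : Fin n, ∀ p ∈ Finset.Iic k.castSucc, ∀ q ∈ Finset.Ioi k.castSucc, p < q :=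
    fun k p hp q hq => (Finset.mem_Iic.1 hp).trans_lt (Finset.mem_Ioi.1 hq)
  have hnn : 0 ≤ ((n : ℝ) + 1) * lam (dualVec n j) := by
    rw [key]
    exact Finset.sum_nonneg fun p hp => Finset.sum_nonneg fun q hq =>
      h.apply_diffVec_nonneg (hlt j p hp q hq)
  refine lt_of_le_of_ne (nonneg_of_mul_nonneg_right hnn hn1) fun h0 => ?_
  have hj : ∀ p q, p ≤ j.castSucc → j.castSucc < q → lam (diffVec n p q) = 0 := by
    intro p q hp hq
    have h1 := key j
    rw [← h0, mul_zero, eq_comm, Finset.sum_eq_zero_iff_of_nonneg fun p hp =>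
      Finset.sum_nonneg fun q hq => h.apply_diffVec_nonneg (hlt j p hp q hq)] at h1
    have h2 := h1 p (Finset.mem_Iic.2 hp)
    rw [Finset.sum_eq_zero_iff_of_nonneg fun q hq =>
      h.apply_diffVec_nonneg (hlt j p (Finset.mem_Iic.2 hp) q hq)] at h2
    exact h2 q (Finset.mem_Ioi.2 hq)
  have hsub : ∀ p q r, diffVec n p q = diffVec n r q - diffVec n r p := by
    intro p q r
    apply Subtype.ext
    simp [diffVec]
  have hlast : ∀ p, lam (diffVec n p (Fin.last n)) = 0 := by
    intro p
    rcases le_or_gt p j.castSucc with hp | hp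
    · exact hj p _ hp (Fin.castSucc_lt_last j)
    · rw [hsub p _ 0, map_sub, hj _ _ (Fin.zero_le _) (Fin.castSucc_lt_last j),
        hj _ _ (Fin.zero_le _) hp, sub_zero]
  have hall : ∀ p q, lam (diffVec n p q) = 0 := by
    intro p q
    have : diffVec n p q = diffVec n p (Fin.last n) - diffVec n q (Fin.last n) := by
      apply Subtype.ext
      simp [diffVec]
    rw [this, map_sub, hlast, hlast, sub_zero]
  refine h.ne_zero hn hτ hτnontriv hτirr (LinearMap.ext fun H => ?_)
  rw [eq_sum_simpleRoot_smul_dualVec H, map_sum]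
  refine Finset.sum_eq_zero fun k _ => ?_
  have hk := key k
  simp only [hall, Finset.sum_const_zero] at hk
  rw [map_smul, (mul_eq_zero.1 hk).resolve_left hn1.ne', smul_zero]

/-! ### The Cartan decomposition -/

theorem mem_K_iff {n : ℕ} {k : G n} :
    k ∈ K n ↔ (k : Matrix (Fin (n + 1)) (Fin (n + 1)) ℝ)ᵀ *
      (k : Matrix (Fin (n + 1)) (Fin (n + 1)) ℝ) = 1 := by
  change (k : Matrix (Fin (n + 1)) (Fin (n + 1)) ℝ) ∈
    Matrix.specialOrthogonalGroup (Fin (n + 1)) ℝ ↔ _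
  rw [Matrix.mem_specialOrthogonalGroup_iff, Matrix.mem_orthogonalGroup_iff']
  exact ⟨fun h => h.1, fun h => ⟨h, k.2⟩⟩

/-- A positive definite matrix is diagonalized by an element of `SO(n+1)`, with the eigenvalues in
decreasing order. -/
theorem exists_mem_K_diagonalize {n : ℕ} {S : Matrix (Fin (n + 1)) (Fin (n + 1)) ℝ}
    (hS : S.PosDef) : ∃ k ∈ K n, ∃ d : Fin (n + 1) → ℝ, (∀ i, 0 < d i) ∧ Antitone d ∧
      (k : Matrix (Fin (n + 1)) (Fin (n + 1)) ℝ)ᵀ * S *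
        (k : Matrix (Fin (n + 1)) (Fin (n + 1)) ℝ) = Matrix.diagonal d := by
  set e := hS.1.eigenvalues
  set U : Matrix (Fin (n + 1)) (Fin (n + 1)) ℝ := hS.1.eigenvectorUnitary.1
  have hU : Uᵀ * U = 1 := (Matrix.mem_orthogonalGroup_iff' _ ℝ).1 hS.1.eigenvectorUnitary.2
  have hUS : Uᵀ * S * U = Matrix.diagonal e := by
    have h := hS.1.conjStarAlgAut_star_eigenvectorUnitary
    rw [Unitary.conjStarAlgAut_apply] at h
    have h' : star U * S * U = Matrix.diagonal e := by simpa using h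
    rwa [Matrix.star_eq_conjTranspose, Matrix.conjTranspose_eq_transpose_of_trivial] at h'
  set σ : Equiv.Perm (Fin (n + 1)) := Tuple.sort fun i => -e i
  have hσ : Antitone (e ∘ σ) := by
    have := Tuple.monotone_sort fun i => -e i
    intro i j hij
    have := this hij
    simpa using this
  -- the eigenvectors in the order of the eigenvalues, the first one with its sign still free
  set V : Matrix (Fin (n + 1)) (Fin (n + 1)) ℝ := U.submatrix id σ
  have hV : Vᵀ * V = 1 := by
    have : Vᵀ * V = (Uᵀ * U).submatrix σ σ := by
      ext i j
      simp [V, Matrix.mul_apply]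
    rw [this, hU, Matrix.submatrix_one_equiv]
  have hVS : Vᵀ * S * V = Matrix.diagonal (e ∘ σ) := by
    have : Vᵀ * S * V = (Uᵀ * S * U).submatrix σ σ := by
      ext i j
      simp [V, Matrix.mul_apply]
    rw [this, hUS, Matrix.submatrix_diagonal_equiv]
  have hdet : V.det * V.det = 1 := by
    have := congrArg Matrix.det hV
    rwa [Matrix.det_mul, Matrix.det_transpose, Matrix.det_one] at this
  set ε : Fin (n + 1) → ℝ := Function.update 1 0 V.det
  have hε : ∀ i, ε i * ε i = 1 := by
    intro i
    rcases eq_or_ne i 0 with rfl | hi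
    · simpa [ε] using hdet
    · simp [ε, hi]
  have hconj : ∀ d : Fin (n + 1) → ℝ,
      Matrix.diagonal ε * Matrix.diagonal d * Matrix.diagonal ε = Matrix.diagonal d := by
    intro d
    rw [Matrix.diagonal_mul_diagonal, Matrix.diagonal_mul_diagonal]
    congr 1
    funext i
    linear_combination d i * hε i
  have hdetW : (V * Matrix.diagonal ε).det = 1 := by
    rw [Matrix.det_mul, Matrix.det_diagonal, Finset.prod_update_of_mem (Finset.mem_univ _)]
    simpa using hdet
  refine ⟨⟨V * Matrix.diagonal ε, hdetW⟩, mem_K_iff.2 ?_, e ∘ σ,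
    fun i => hS.eigenvalues_pos _, hσ, ?_⟩
  · change (V * Matrix.diagonal ε)ᵀ * (V * Matrix.diagonal ε) = 1
    calc (V * Matrix.diagonal ε)ᵀ * (V * Matrix.diagonal ε)
        = Matrix.diagonal ε * (Vᵀ * V) * Matrix.diagonal ε := by
          simp only [Matrix.transpose_mul, Matrix.diagonal_transpose, Matrix.mul_assoc]
      _ = 1 := by rw [hV, ← Matrix.diagonal_one, hconj]
  · change (V * Matrix.diagonal ε)ᵀ * S * (V * Matrix.diagonal ε) = _
    calc (V * Matrix.diagonal ε)ᵀ * S * (V * Matrix.diagonal ε)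
        = Matrix.diagonal ε * (Vᵀ * S * V) * Matrix.diagonal ε := by
          simp only [Matrix.transpose_mul, Matrix.diagonal_transpose, Matrix.mul_assoc]
      _ = _ := by rw [hVS, hconj]

/-- The Cartan decomposition `G = K exp(𝔞⁺) K`. -/
theorem exists_eq_mul_expA_mul {n : ℕ} (g : G n) :
    ∃ k₁ ∈ K n, ∃ H ∈ chamber n, ∃ k₂ ∈ K n, g = k₁ * expA H * k₂ := by
  set g' : Matrix (Fin (n + 1)) (Fin (n + 1)) ℝ := (g : Matrix (Fin (n + 1)) (Fin (n + 1)) ℝ)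
    with hg'
  have hpd : (g'ᵀ * g').PosDef := by
    have hu : IsUnit g' := (Matrix.isUnit_iff_isUnit_det g').2 (by rw [g.2]; exact isUnit_one)
    have := (Matrix.PosDef.one (n := Fin (n + 1)) (R := ℝ)).conjTranspose_mul_mul_same
      (B := g') (Matrix.mulVec_injective_of_isUnit hu)
    simpa using this
  obtain ⟨k, hk, d, hd, hanti, hkd⟩ := exists_mem_K_diagonalize hpd
  have hprod : ∏ i, d i = 1 := by
    have := congrArg Matrix.det hkd
    rw [Matrix.det_diagonal] at this
    rw [← this]
    simp only [Matrix.det_mul, Matrix.det_transpose]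
    rw [k.2, g.2]
    norm_num
  let H : Cartan n := ⟨fun i => Real.log (d i) / 2, by
    change ∑ i, Real.log (d i) / 2 = 0
    rw [← Finset.sum_div, ← Real.log_prod fun i _ => (hd i).ne', hprod, Real.log_one, zero_div]⟩
  have hH : H ∈ chamber n := by
    intro i
    have h1 : d i.succ ≤ d i.castSucc := hanti (Fin.castSucc_lt_succ).le
    have h2 := Real.log_le_log (hd _) h1
    change 0 ≤ Real.log (d i.castSucc) / 2 - Real.log (d i.succ) / 2
    linarith
  have hexp : expA (-H) * expA H = 1 := by rw [← expA_add, neg_add_cancel, expA_zero]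
  refine ⟨g * k * expA (-H), mem_K_iff.2 ?_, H, hH, k⁻¹, (K n).inv_mem hk, ?_⟩
  · rw [Matrix.SpecialLinearGroup.coe_mul, Matrix.SpecialLinearGroup.coe_mul, ← hg', coe_expA]
    set k' : Matrix (Fin (n + 1)) (Fin (n + 1)) ℝ := (k : Matrix (Fin (n + 1)) (Fin (n + 1)) ℝ)
    set a : Matrix (Fin (n + 1)) (Fin (n + 1)) ℝ := Matrix.diagonal fun i => Real.exp ((-H).1 i)
      with ha
    have hat : aᵀ = a := Matrix.diagonal_transpose _
    calc (g' * k' * a)ᵀ * (g' * k' * a) = a * (k'ᵀ * (g'ᵀ * g') * k') * a := by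
          simp only [Matrix.transpose_mul, hat, Matrix.mul_assoc]
      _ = 1 := by
          rw [hkd, ha, Matrix.diagonal_mul_diagonal, Matrix.diagonal_mul_diagonal,
            ← Matrix.diagonal_one]
          congr 1
          funext i
          change Real.exp (-(Real.log (d i) / 2)) * d i * Real.exp (-(Real.log (d i) / 2)) = 1
          nth_rewrite 2 [← Real.exp_log (hd i)]
          rw [← Real.exp_add, ← Real.exp_add]
          ring_nf
          exact Real.exp_zero
  · rw [mul_assoc _ (expA (-H)), hexp, mul_one, mul_assoc, mul_inv_cancel, mul_one]

/-! ### Compact sets in `SL(n+1, ℝ)` -/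

/-- The matrices in `SL(n+1, ℝ)` with entries of modulus at most `R`. -/
def entryBox (n : ℕ) (R : ℝ) : Set (G n) := {g | ∀ i j, |g.1 i j| ≤ R}

theorem isCompact_entryBox (n : ℕ) (R : ℝ) : IsCompact (entryBox n R) := by
  have h : IsCompact (Set.univ.pi fun _ : Fin (n + 1) => Set.univ.pi fun _ : Fin (n + 1) =>
      Set.Icc (-R) R) := isCompact_univ_pi fun _ => isCompact_univ_pi fun _ => isCompact_Icc
  have he : entryBox n R = (fun g : G n => g.1) ⁻¹' (Set.univ.pi fun _ : Fin (n + 1) =>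
      Set.univ.pi fun _ : Fin (n + 1) => Set.Icc (-R) R) := by
    ext g
    exact ⟨fun hg i _ j _ => abs_le.1 (hg i j),
      fun hg i j => abs_le.2 (hg i (Set.mem_univ i) j (Set.mem_univ j))⟩
  rw [he]
  exact Matrix.SpecialLinearGroup.isClosedEmbedding_val.isCompact_preimage h

theorem exists_subset_entryBox {n : ℕ} {S : Set (G n)} (hS : IsCompact S) :
    ∃ R, 1 ≤ R ∧ S ⊆ entryBox n R := by
  have h : ∀ i j : Fin (n + 1), ∃ R, ∀ g ∈ S, |g.1 i j| ≤ R := by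
    intro i j
    have hc : Continuous fun g : G n => |g.1 i j| :=
      ((continuous_subtype_val).matrix_elem i j).abs
    obtain ⟨R, hR⟩ := (hS.image hc).bddAbove
    exact ⟨R, fun g hg => hR ⟨g, hg, rfl⟩⟩
  choose R hR using h
  refine ⟨1 + ∑ i, ∑ j, |R i j|, le_add_of_nonneg_right (by positivity), fun g hg i j => ?_⟩
  have h1 : |R i j| ≤ ∑ j, |R i j| :=
    Finset.single_le_sum (f := fun j => |R i j|) (fun _ _ => abs_nonneg _) (Finset.mem_univ j)
  have h2 : ∑ j, |R i j| ≤ ∑ i, ∑ j, |R i j| :=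
    Finset.single_le_sum (f := fun i => ∑ j, |R i j|) (fun _ _ => by positivity)
      (Finset.mem_univ i)
  linarith [hR i j g hg, le_abs_self (R i j)]

theorem isCompact_K (n : ℕ) : IsCompact (K n : Set (G n)) := by
  refine (isCompact_entryBox n 1).of_isClosed_subset ?_ ?_
  · have : (K n : Set (G n)) = {g | (g.1)ᵀ * g.1 = 1} := by
      ext g
      exact mem_K_iff
    rw [this]
    exact isClosed_eq (by fun_prop) continuous_const
  · intro g hg i j
    have h : g.1 ∈ Matrix.orthogonalGroup (Fin (n + 1)) ℝ :=
      (Matrix.mem_specialOrthogonalGroup_iff.1 hg).1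
    simpa using entry_norm_bound_of_unitary h i j

theorem continuous_expA {n : ℕ} : Continuous (expA : Cartan n → G n) := by
  refine continuous_induced_rng.2 ?_
  change Continuous fun H : Cartan n => Matrix.diagonal fun i => Real.exp (H.1 i)
  exact (continuous_pi fun i => Real.continuous_exp.comp
    ((continuous_apply i).comp continuous_subtype_val)).matrix_diagonal

/-! ### Triangular matrices -/

/-- The unipotent lower triangular matrix with entries `f i j` below the diagonal. -/
def lowerUnipotent {n : ℕ} (f : Fin (n + 1) → Fin (n + 1) → ℝ) : G n :=
  ⟨Matrix.of fun i j => if j < i then f i j else if j = i then 1 else 0, by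
    rw [Matrix.det_of_isLowerTriangular]
    · simp
    · intro i j hij
      have hij : i < j := hij
      simp [hij.not_gt, hij.ne']⟩

theorem lowerUnipotent_apply {n : ℕ} (f : Fin (n + 1) → Fin (n + 1) → ℝ) (i j : Fin (n + 1)) :
    (lowerUnipotent f).1 i j = if j < i then f i j else if j = i then 1 else 0 := rfl

section

attribute [local instance] Matrix.linftyOpNormedRing Matrix.linftyOpNormedAlgebra

/-- The `LU` decomposition near the identity: the map `M ↦ (1 + L)(1 + U)`, where `L` and `U` are
the strictly lower and the upper triangular part of `M`, has the identity as its derivative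
at `0`. -/
theorem eventually_eq_lowerUnipotent_mul_upper (n : ℕ) :
    ∀ᶠ g in nhds (1 : G n), ∃ (f : Fin (n + 1) → Fin (n + 1) → ℝ) (y : G n),
      g = lowerUnipotent f * y ∧ (∀ i j, |f i j| ≤ 1) ∧ (∀ i j, j < i → y.1 i j = 0) ∧
        y ∈ entryBox n 2 := by
  let low : Matrix (Fin (n + 1)) (Fin (n + 1)) ℝ →ₗ[ℝ] Matrix (Fin (n + 1)) (Fin (n + 1)) ℝ :=
    { toFun := fun M => Matrix.of fun i j => if j < i then M i j else 0
      map_add' := fun M M' => by ext i j; by_cases h : j < i <;> simp [h]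
      map_smul' := fun c M => by ext i j; by_cases h : j < i <;> simp [h] }
  let L := LinearMap.toContinuousLinearMap low
  let U := LinearMap.toContinuousLinearMap (LinearMap.id - low)
  have hL : ∀ M i j, L M i j = if j < i then M i j else 0 := fun _ _ _ => rfl
  have hU : ∀ M i j, U M i j = if j < i then 0 else M i j := by
    intro M i j
    change M i j - (if j < i then M i j else 0) = _
    split_ifs <;> simp
  have hLU : ∀ M, U M + L M = M := by
    intro M
    exact sub_add_cancel M (low M)
  have hder : HasStrictFDerivAt (fun M => (1 + L M) * (1 + U M))
      (ContinuousLinearMap.id ℝ (Matrix (Fin (n + 1)) (Fin (n + 1)) ℝ)) 0 := by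
    have := (L.hasStrictFDerivAt.const_add 1 (x := 0)).mul'
      (U.hasStrictFDerivAt.const_add 1 (x := 0))
    refine this.congr_fderiv ?_
    ext M : 1
    change (1 + L 0) * U M + L M * (1 + U 0) = M
    rw [map_zero, map_zero, add_zero, one_mul, mul_one]
    exact hLU M
  have hmap : Filter.map (fun M => (1 + L M) * (1 + U M))
      (nhds (0 : Matrix (Fin (n + 1)) (Fin (n + 1)) ℝ)) = nhds 1 := by
    have h := hder.map_nhds_eq_of_surj (LinearMap.range_eq_top.2 fun x => ⟨x, rfl⟩)
    simp only [map_zero, add_zero, mul_one] at h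
    exact h
  have hbox : {M : Matrix (Fin (n + 1)) (Fin (n + 1)) ℝ | ∀ i j, |M i j| < 1} ∈ nhds 0 := by
    have hopen : IsOpen {M : Matrix (Fin (n + 1)) (Fin (n + 1)) ℝ | ∀ i j, |M i j| < 1} := by
      simp only [Set.ofPred_forall]
      exact isOpen_iInter_of_finite fun i => isOpen_iInter_of_finite fun j =>
        isOpen_lt (continuous_id.matrix_elem i j).abs continuous_const
    exact hopen.mem_nhds fun i j => by simp
  have himg := Filter.image_mem_map (m := fun M => (1 + L M) * (1 + U M)) hbox
  rw [hmap] at himg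
  have hval : Filter.Tendsto (fun g : G n => g.1) (nhds 1)
      (nhds (1 : Matrix (Fin (n + 1)) (Fin (n + 1)) ℝ)) := continuous_subtype_val.tendsto' _ _ rfl
  filter_upwards [hval himg] with g hg
  obtain ⟨M, hM, hMg⟩ := hg
  have hMg : (1 + L M) * (1 + U M) = g.1 := hMg
  have hLM : (lowerUnipotent fun i j => M i j).1 = 1 + L M := by
    ext i j
    rw [lowerUnipotent_apply, Matrix.add_apply, hL, Matrix.one_apply]
    rcases lt_trichotomy j i with h | h | h
    · simp [h, h.ne']
    · simp [h]
    · simp [h.ne, h.ne', h.not_gt]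
  have hdet : (1 + U M).det = 1 := by
    have h := congrArg Matrix.det hMg
    rw [Matrix.det_mul, ← hLM, (lowerUnipotent fun i j => M i j).2, one_mul] at h
    rw [h, g.2]
  refine ⟨fun i j => M i j, ⟨1 + U M, hdet⟩, ?_, fun i j => (hM i j).le, ?_, ?_⟩
  · apply Subtype.ext
    change g.1 = (lowerUnipotent fun i j => M i j).1 * (1 + U M)
    rw [hLM, hMg]
  · intro i j hij
    change (1 : Matrix (Fin (n + 1)) (Fin (n + 1)) ℝ) i j + U M i j = 0
    rw [hU, Matrix.one_apply_ne hij.ne', if_pos hij, add_zero]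
  · intro i j
    change |(1 : Matrix (Fin (n + 1)) (Fin (n + 1)) ℝ) i j + U M i j| ≤ 2
    have h1 : |(1 : Matrix (Fin (n + 1)) (Fin (n + 1)) ℝ) i j| ≤ 1 := by
      rw [Matrix.one_apply]
      split_ifs <;> simp
    have h2 : |U M i j| ≤ 1 := by
      rw [hU]
      split_ifs
      · simp
      · exact (hM i j).le
    linarith [abs_add_le ((1 : Matrix (Fin (n + 1)) (Fin (n + 1)) ℝ) i j) (U M i j)]

end

/-- Conjugation by an element of `exp(𝔞)` in coordinates. -/
theorem expA_neg_mul_mul_expA_apply {n : ℕ} (H : Cartan n) (g : G n) (i j : Fin (n + 1)) :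
    (expA (-H) * g * expA H).1 i j = Real.exp (H.1 j - H.1 i) * g.1 i j := by
  rw [Matrix.SpecialLinearGroup.coe_mul, Matrix.SpecialLinearGroup.coe_mul, coe_expA, coe_expA,
    Matrix.mul_diagonal, Matrix.diagonal_mul]
  change Real.exp (-(H.1 i)) * _ * _ = _
  rw [sub_eq_add_neg, Real.exp_add]
  ring

theorem antitone_of_mem_chamber {n : ℕ} {H : Cartan n} (hH : H ∈ chamber n) : Antitone H.1 :=
  Fin.antitone_iff_succ_le.2 fun i => sub_nonneg.1 (hH i)

/-! ### Volume of `K exp(H) Ω` -/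

/-- Row reduction modulo one: an integral combination of the rows of a unipotent lower triangular
matrix, starting with the `i`-th one, has all entries to the left of the diagonal bounded
by `1`. -/
theorem exists_int_row {n : ℕ} {z : Matrix (Fin (n + 1)) (Fin (n + 1)) ℝ}
    (h0 : ∀ k j, k < j → z k j = 0) (h1 : ∀ k, z k k = 1) (i : Fin (n + 1)) :
    ∃ d : Fin (n + 1) → ℤ, d i = 1 ∧ (∀ k, i < k → d k = 0) ∧
      ∀ j, j < i → |∑ k, (d k : ℝ) * z k j| ≤ 1 := by
  have key : ∀ t : ℕ, t ≤ i → ∃ d : Fin (n + 1) → ℤ, d i = 1 ∧ (∀ k, i < k → d k = 0) ∧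
      ∀ j : Fin (n + 1), (i : ℕ) - t ≤ j → j < i → |∑ k, (d k : ℝ) * z k j| ≤ 1 := by
    intro t
    induction t with
    | zero =>
      intro _
      refine ⟨Pi.single i 1, by simp, fun k hk => Pi.single_eq_of_ne hk.ne' _, fun j hj hji => ?_⟩
      have : (j : ℕ) < i := hji
      omega
    | succ t ih =>
      intro ht
      obtain ⟨d, hd1, hd2, hd3⟩ := ih (by omega)
      -- the column treated at this step
      let c : Fin (n + 1) := ⟨(i : ℕ) - (t + 1), by omega⟩
      have hc : (c : ℕ) = (i : ℕ) - (t + 1) := rfl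
      have hci : c < i := by rw [Fin.lt_def]; omega
      set s := ∑ k, (d k : ℝ) * z k c with hs
      have hsum : ∀ j, ∑ k, ((d k + if k = c then -⌊s⌋ else 0 : ℤ) : ℝ) * z k j =
          ∑ k, (d k : ℝ) * z k j - ⌊s⌋ * z c j := by
        intro j
        simp [add_mul, Finset.sum_add_distrib, sub_eq_add_neg]
      refine ⟨fun k => d k + if k = c then -⌊s⌋ else 0, ?_, fun k hk => ?_, fun j hj hji => ?_⟩
      · simp [hd1, hci.ne']
      · simp [hd2 k hk, (hci.trans hk).ne']
      · rw [hsum]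
        rcases lt_or_ge (c : ℕ) j with hjc | hjc
        · rw [h0 c j hjc, mul_zero, sub_zero]
          exact hd3 j (by omega) hji
        · obtain rfl : j = c := by apply Fin.ext; omega
          rw [h1, mul_one, ← hs, abs_le]
          constructor <;> linarith [Int.floor_le s, Int.lt_floor_add_one s]
  obtain ⟨d, hd1, hd2, hd3⟩ := key i le_rfl
  exact ⟨d, hd1, hd2, fun j hj => hd3 j (by omega) hj⟩

/-- The integral unipotent lower triangular matrices have a bounded fundamental domain. -/
theorem exists_int_lowerUnipotent_mul {n : ℕ} (z : G n) (h0 : ∀ k j, k < j → z.1 k j = 0)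
    (h1 : ∀ k, z.1 k k = 1) :
    ∃ δ : Fin (n + 1) → Fin (n + 1) → ℤ,
      lowerUnipotent (fun i j => (δ i j : ℝ)) * z ∈ entryBox n 1 ∧
      ∀ i j, i < j → (lowerUnipotent (fun i j => (δ i j : ℝ)) * z).1 i j = 0 := by
  choose δ hδ1 hδ2 hδ3 using exists_int_row (z := z.1) h0 h1
  have hent : ∀ i k, (lowerUnipotent (fun i j => (δ i j : ℝ))).1 i k = (δ i k : ℝ) := by
    intro i k
    rw [lowerUnipotent_apply]
    rcases lt_trichotomy k i with h | rfl | h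
    · simp [h]
    · simp [hδ1]
    · simp [h.not_gt, h.ne', hδ2 i k h]
  have hmul : ∀ i j, (lowerUnipotent (fun i j => (δ i j : ℝ)) * z).1 i j =
      ∑ k, (δ i k : ℝ) * z.1 k j := by
    intro i j
    rw [Matrix.SpecialLinearGroup.coe_mul, Matrix.mul_apply]
    simp only [hent]
  have hzero : ∀ i j, i < j → ∑ k, (δ i k : ℝ) * z.1 k j = 0 := by
    intro i j hij
    refine Finset.sum_eq_zero fun k _ => ?_
    rcases lt_or_ge k j with hk | hk
    · rw [h0 k j hk, mul_zero]
    · rw [hδ2 i k (hij.trans_le hk), Int.cast_zero, zero_mul]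
  refine ⟨δ, fun i j => ?_, fun i j hij => (hmul i j).trans (hzero i j hij)⟩
  rw [hmul]
  rcases lt_trichotomy j i with h | rfl | h
  · exact hδ3 i j h
  · rw [Finset.sum_eq_single j]
    · simp [hδ1, h1]
    · intro k _ hk
      rcases lt_or_gt_of_ne hk with hk | hk
      · rw [h0 k j hk, mul_zero]
      · rw [hδ2 j k hk, Int.cast_zero, zero_mul]
    · simp
  · rw [hzero i j h]
    simp

/-- The integer arrays whose entry at `(i, j)`, `j < i`, is at most `R e^{hⱼ - hᵢ}` in modulus. -/
noncomputable def intArrays {n : ℕ} (R : ℝ) (H : Cartan n) :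
    Finset (Fin (n + 1) → Fin (n + 1) → ℤ) :=
  Fintype.piFinset fun i => Fintype.piFinset fun j =>
    if j < i then Finset.Icc (-⌊R * Real.exp (H.1 j - H.1 i)⌋) ⌊R * Real.exp (H.1 j - H.1 i)⌋
    else {0}

theorem twoRho_apply {n : ℕ} (H : Cartan n) :
    twoRho n H = ∑ i, ∑ j, if j < i then H.1 j - H.1 i else 0 := by
  rw [twoRho, LinearMap.sum_apply, Finset.sum_filter, Fintype.sum_prod_type, Finset.sum_comm]
  rfl

theorem card_intArrays_le {n : ℕ} {R : ℝ} (hR : 1 ≤ R) {H : Cartan n} (hH : H ∈ chamber n) :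
    ((intArrays R H).card : ℝ) ≤ (3 * R) ^ ((n + 1) * (n + 1)) * Real.exp (twoRho n H) := by
  have hanti := antitone_of_mem_chamber hH
  have hone : ∀ i j : Fin (n + 1),
      ((if j < i then Finset.Icc (-⌊R * Real.exp (H.1 j - H.1 i)⌋) ⌊R * Real.exp (H.1 j - H.1 i)⌋
        else {0} : Finset ℤ).card : ℝ) ≤
        3 * R * Real.exp (if j < i then H.1 j - H.1 i else 0) := by
    intro i j
    split_ifs with hij
    · have he : 1 ≤ Real.exp (H.1 j - H.1 i) := Real.one_le_exp (sub_nonneg.2 (hanti hij.le))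
      have hRe : 1 ≤ R * Real.exp (H.1 j - H.1 i) := one_le_mul_of_one_le_of_one_le hR he
      set M := ⌊R * Real.exp (H.1 j - H.1 i)⌋ with hM
      have hM0 : 0 ≤ M := Int.floor_nonneg.2 (by linarith)
      have hMle : (M : ℝ) ≤ R * Real.exp (H.1 j - H.1 i) := Int.floor_le _
      rw [Int.card_Icc]
      have : (((M + 1 - -M).toNat : ℕ) : ℝ) = 2 * M + 1 := by
        have h : (((M + 1 - -M).toNat : ℕ) : ℤ) = 2 * M + 1 := by
          rw [Int.toNat_of_nonneg (by omega)]; ring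
        exact_mod_cast h
      rw [this]
      linarith
    · simp only [Finset.card_singleton, Nat.cast_one, Real.exp_zero]
      linarith
  calc ((intArrays R H).card : ℝ) = ∏ i, ∏ j,
      ((if j < i then Finset.Icc (-⌊R * Real.exp (H.1 j - H.1 i)⌋) ⌊R * Real.exp (H.1 j - H.1 i)⌋
        else {0} : Finset ℤ).card : ℝ) := by
        simp only [intArrays, Fintype.card_piFinset, Nat.cast_prod]
    _ ≤ ∏ i, ∏ j, 3 * R * Real.exp (if j < i then H.1 j - H.1 i else 0) :=
        Finset.prod_le_prod (fun _ _ => Finset.prod_nonneg fun _ _ => by positivity) fun i _ =>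
          Finset.prod_le_prod (fun _ _ => by positivity) fun j _ => hone i j
    _ = _ := by
        simp only [Finset.prod_mul_distrib, ← Real.exp_sum, Finset.prod_const, Finset.card_univ,
          Fintype.card_fin, ← pow_mul, mul_pow, twoRho_apply]

open scoped Pointwise in
/-- The covering argument: near the identity `k = x y` with `x` unipotent lower and `y` upper
triangular; `exp(H)` contracts `y`, and expands `x` into a region covered by at most a constant
times `e^{2ρ(H)}` integral translates of a fixed compact set. -/
theorem exists_covering (n : ℕ) {Ω : Set (G n)} (hΩ : IsCompact Ω) :
    ∃ (t : Finset (G n)) (R : ℝ) (Ω' : Set (G n)), 1 ≤ R ∧ IsCompact Ω' ∧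
      ∀ H ∈ chamber n, (K n : Set (G n)) * {expA H} * Ω ⊆ ⋃ g ∈ t, ⋃ δ ∈ intArrays R H,
        (g⁻¹ * expA H * (lowerUnipotent fun i j => (δ i j : ℝ))⁻¹) • Ω' := by
  obtain ⟨W, hW, hWeq⟩ := (eventually_eq_lowerUnipotent_mul_upper n).exists_mem
  obtain ⟨t, ht⟩ := compact_covered_by_mul_left_translates (isCompact_K n)
    ⟨1, mem_interior_iff_mem_nhds.2 hW⟩
  obtain ⟨R, hR, hRinv⟩ := exists_subset_entryBox (isCompact_entryBox n 1).inv
  have hR' : (1 : ℝ) ≤ (n + 1) * R := by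
    have : (0 : ℝ) ≤ n := Nat.cast_nonneg _
    nlinarith
  refine ⟨t, (n + 1) * R, entryBox n 1 * entryBox n 2 * Ω, hR',
    ((isCompact_entryBox n 1).mul (isCompact_entryBox n 2)).mul hΩ, fun H hH => ?_⟩
  have hanti := antitone_of_mem_chamber hH
  rintro _ ⟨_, ⟨k, hk, _, rfl, rfl⟩, ω, hω, rfl⟩
  obtain ⟨g, hg, hgW⟩ := Set.mem_iUnion₂.1 (ht hk)
  obtain ⟨f, y, hxy, hf, hy0, hybox⟩ := hWeq _ hgW
  set x : G n := lowerUnipotent f with hx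
  have hxbox : x ∈ entryBox n 1 := by
    intro i j
    rw [hx, lowerUnipotent_apply]
    split_ifs
    · exact hf i j
    · simp
    · simp
  have hxinv : x⁻¹ ∈ entryBox n R := hRinv (Set.inv_mem_inv.2 hxbox)
  set z : G n := expA (-H) * x * expA H with hz
  have hz0 : ∀ k j, k < j → z.1 k j = 0 := fun k j hkj => by
    rw [hz, expA_neg_mul_mul_expA_apply, hx, lowerUnipotent_apply, if_neg hkj.not_gt,
      if_neg hkj.ne', mul_zero]
  have hz1 : ∀ k, z.1 k k = 1 := fun k => by
    rw [hz, expA_neg_mul_mul_expA_apply, hx, lowerUnipotent_apply, if_neg (lt_irrefl _), if_pos rfl,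
      sub_self, Real.exp_zero, mul_one]
  obtain ⟨δ, hδbox, hδ0⟩ := exists_int_lowerUnipotent_mul z hz0 hz1
  set D : G n := lowerUnipotent fun i j => (δ i j : ℝ) with hD
  have hneg : expA (-H) * expA H = 1 := by rw [← expA_add, neg_add_cancel, expA_zero]
  have hneg' : expA H * expA (-H) = 1 := by rw [← expA_add, add_neg_cancel, expA_zero]
  have hinv : expA (-H) = (expA H)⁻¹ := eq_inv_of_mul_eq_one_left hneg
  -- `D = (D z) z⁻¹` bounds the entries of `D`, as those of `D z` and of `x⁻¹` are bounded
  have hδle : ∀ i j, j < i → |(δ i j : ℝ)| ≤ (n + 1) * R * Real.exp (H.1 j - H.1 i) := by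
    intro i j hij
    have hDeq : D = D * z * (expA (-H) * x⁻¹ * expA H) := by
      rw [hz, hinv]; group
    have hDij : D.1 i j = (δ i j : ℝ) := by rw [hD, lowerUnipotent_apply, if_pos hij]
    have hDsum : D.1 i j = ∑ k, (D * z).1 i k * (expA (-H) * x⁻¹ * expA H).1 k j := by
      conv_lhs => rw [hDeq, Matrix.SpecialLinearGroup.coe_mul, Matrix.mul_apply]
    rw [← hDij, hDsum]
    refine (Finset.abs_sum_le_sum_abs _ _).trans ?_
    have : ∀ k ∈ Finset.univ, |(D * z).1 i k * (expA (-H) * x⁻¹ * expA H).1 k j| ≤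
        R * Real.exp (H.1 j - H.1 i) := by
      intro k _
      rcases lt_or_ge i k with hik | hik
      · rw [hδ0 i k hik, zero_mul, abs_zero]
        positivity
      · rw [abs_mul, expA_neg_mul_mul_expA_apply, abs_mul, abs_of_pos (Real.exp_pos _)]
        have e1 : |(D * z).1 i k| ≤ 1 := hδbox i k
        have e2 : |x⁻¹.1 k j| ≤ R := hxinv k j
        have e3 : Real.exp (H.1 j - H.1 k) ≤ Real.exp (H.1 j - H.1 i) :=
          Real.exp_le_exp.2 (by linarith [hanti hik])
        calc |(D * z).1 i k| * (Real.exp (H.1 j - H.1 k) * |x⁻¹.1 k j|)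
            ≤ 1 * (Real.exp (H.1 j - H.1 i) * R) := by gcongr
          _ = _ := by ring
    refine (Finset.sum_le_card_nsmul _ _ _ this).trans (le_of_eq ?_)
    simp
    ring
  have hybox' : expA (-H) * y * expA H ∈ entryBox n 2 := by
    intro i j
    rw [expA_neg_mul_mul_expA_apply]
    rcases lt_or_ge j i with hij | hij
    · rw [hy0 i j hij]; simp
    · rw [abs_mul, abs_of_pos (Real.exp_pos _)]
      have e1 : Real.exp (H.1 j - H.1 i) ≤ 1 := Real.exp_le_one_iff.2 (by linarith [hanti hij])
      have e2 : |y.1 i j| ≤ 2 := hybox i j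
      calc _ ≤ 1 * (2 : ℝ) := by gcongr
        _ = 2 := one_mul _
  refine Set.mem_iUnion₂.2 ⟨g, hg, Set.mem_iUnion₂.2
    ⟨fun i j => if j < i then δ i j else 0, ?_, ?_⟩⟩
  · rw [intArrays, Fintype.mem_piFinset]
    intro i
    rw [Fintype.mem_piFinset]
    intro j
    by_cases hij : j < i
    · simp only [hij, if_true, Finset.mem_Icc, ← abs_le]
      rw [Int.le_floor]
      exact_mod_cast hδle i j hij
    · simp [hij]
  · have hDD : (lowerUnipotent fun i j => ((if j < i then δ i j else 0 : ℤ) : ℝ)) = D := by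
      apply Subtype.ext
      ext i j
      rw [hD, lowerUnipotent_apply, lowerUnipotent_apply]
      split_ifs <;> rfl
    rw [hDD]
    refine ⟨D * z * (expA (-H) * y * expA H) * ω,
      Set.mul_mem_mul (Set.mul_mem_mul hδbox hybox') hω, ?_⟩
    have hk' : k = g⁻¹ * (x * y) := by rw [← hxy]; group
    change g⁻¹ * expA H * D⁻¹ * (D * z * (expA (-H) * y * expA H) * ω) = k * expA H * ω
    rw [hk', hz, hinv]
    group

open scoped Pointwise in
/-- The upper bound in the integration formula for the Cartan decomposition. -/
theorem exists_measure_K_mul_expA_mul_le (n : ℕ) [MeasurableSpace (G n)] [BorelSpace (G n)]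
    (vol : Measure (G n)) [vol.IsHaarMeasure] {Ω : Set (G n)} (hΩ : IsCompact Ω) :
    ∃ C : ℝ, 0 ≤ C ∧ ∀ H ∈ chamber n, vol ((K n : Set (G n)) * {expA H} * Ω) ≤
      ENNReal.ofReal (C * Real.exp (twoRho n H)) := by
  obtain ⟨t, R, Ω', hR, hΩ', hcov⟩ := exists_covering n hΩ
  have hfin : vol Ω' ≠ ⊤ := hΩ'.measure_lt_top.ne
  refine ⟨t.card * (3 * R) ^ ((n + 1) * (n + 1)) * (vol Ω').toReal, by positivity,
    fun H hH => ?_⟩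
  calc vol ((K n : Set (G n)) * {expA H} * Ω)
      ≤ ∑ g ∈ t, ∑ δ ∈ intArrays R H, vol Ω' := by
        refine (measure_mono (hcov H hH)).trans ((measure_biUnion_finset_le _ _).trans ?_)
        refine Finset.sum_le_sum fun g _ => (measure_biUnion_finset_le _ _).trans ?_
        refine Finset.sum_le_sum fun δ _ => ?_
        rw [measure_smul]
    _ = ENNReal.ofReal (t.card * (intArrays R H).card * (vol Ω').toReal) := by
        rw [ENNReal.ofReal_mul (by positivity), ENNReal.ofReal_toReal hfin,
          ENNReal.ofReal_mul (by positivity), ENNReal.ofReal_natCast, ENNReal.ofReal_natCast]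
        simp [mul_assoc]
    _ ≤ _ := by
        refine ENNReal.ofReal_le_ofReal ?_
        have := card_intArrays_le hR hH
        calc (t.card : ℝ) * (intArrays R H).card * (vol Ω').toReal
            ≤ t.card * ((3 * R) ^ ((n + 1) * (n + 1)) * Real.exp (twoRho n H)) *
              (vol Ω').toReal := by gcongr
          _ = _ := by ring

/-! ### The unit cells of the Weyl chamber -/

/-- The lattice points of the Weyl chamber in the basis of fundamental coweights. -/
noncomputable def latticePoint {n : ℕ} (m : Fin n → ℕ) : Cartan n :=
  ∑ j, (m j : ℝ) • dualVec n j

/-- The parallelepiped spanned by the fundamental coweights. -/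
noncomputable def unitCell (n : ℕ) : Set (Cartan n) :=
  (fun t : Fin n → ℝ => ∑ j, t j • dualVec n j) '' Set.univ.pi fun _ => Set.Icc 0 1

open scoped Pointwise in
/-- A compact set containing `K exp(H) K` for all `H` in the unit cell based at a lattice point. -/
noncomputable def shell {n : ℕ} (m : Fin n → ℕ) : Set (G n) :=
  (K n : Set (G n)) * {expA (latticePoint m)} * (expA '' unitCell n * (K n : Set (G n)))

theorem isCompact_unitCell (n : ℕ) : IsCompact (unitCell n) :=
  (isCompact_univ_pi fun _ => isCompact_Icc).image
    (continuous_finsetSum _ fun j _ => (continuous_apply j).smul continuous_const)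

open scoped Pointwise in
theorem isCompact_expA_unitCell_mul_K (n : ℕ) :
    IsCompact (expA '' unitCell n * (K n : Set (G n))) :=
  ((isCompact_unitCell n).image continuous_expA).mul (isCompact_K n)

theorem isCompact_shell {n : ℕ} (m : Fin n → ℕ) : IsCompact (shell m) :=
  ((isCompact_K n).mul isCompact_singleton).mul (isCompact_expA_unitCell_mul_K n)

theorem apply_sum_smul_dualVec {n : ℕ} (L : Module.Dual ℝ (Cartan n)) (t : Fin n → ℝ) :
    L (∑ j, t j • dualVec n j) = ∑ j, t j * L (dualVec n j) := by
  simp [map_sum]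

theorem sum_smul_dualVec_mem_chamber {n : ℕ} {t : Fin n → ℝ} (ht : ∀ j, 0 ≤ t j) :
    ∑ j, t j • dualVec n j ∈ chamber n := by
  intro i
  rw [apply_sum_smul_dualVec]
  simpa [simpleRoot_dualVec] using ht i

theorem latticePoint_mem_chamber {n : ℕ} (m : Fin n → ℕ) : latticePoint m ∈ chamber n :=
  sum_smul_dualVec_mem_chamber fun _ => Nat.cast_nonneg _

theorem exists_mem_shell_of_mem_ball {n N : ℕ} {τ : G n →* GL (Fin N) ℝ}
    (hτK : ∀ k ∈ K n,
      (τ k : Matrix (Fin N) (Fin N) ℝ) ∈ Matrix.specialOrthogonalGroup (Fin N) ℝ)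
    {lam : Module.Dual ℝ (Cartan n)} (hlam : IsWeight τ lam)
    (hpos : ∀ j, 0 < lam (dualVec n j)) {T : ℝ} {g : G n} (hg : g ∈ ball τ T) :
    ∃ m : Fin n → ℕ, ∑ j, (m j : ℝ) * lam (dualVec n j) ≤ Real.log T ∧ g ∈ shell m := by
  obtain ⟨k₁, hk₁, H, hH, k₂, hk₂, rfl⟩ := exists_eq_mul_expA_mul g
  have hHT : lam H ≤ Real.log T := by
    have h1 : normTau τ (k₁ * expA H * k₂) ≤ T := hg
    rw [normTau_mul_mul hτK hk₁ hk₂] at h1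
    have h2 := (exp_le_normTau hlam H).trans h1
    exact (Real.le_log_iff_exp_le ((Real.exp_pos _).trans_le h2)).2 h2
  set t : Fin n → ℝ := fun j => simpleRoot n j H with ht
  have hHt : H = ∑ j, t j • dualVec n j := eq_sum_simpleRoot_smul_dualVec H
  have hfl : ∀ j, (⌊t j⌋₊ : ℝ) ≤ t j := fun j => Nat.floor_le (hH j)
  refine ⟨fun j => ⌊t j⌋₊, ?_, ?_⟩
  · refine le_trans (Finset.sum_le_sum fun j _ => ?_)
      (le_trans (le_of_eq (apply_sum_smul_dualVec lam t).symm) (hHt ▸ hHT))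
    exact mul_le_mul_of_nonneg_right (hfl j) (hpos j).le
  · have hsplit : H = latticePoint (fun j => ⌊t j⌋₊) +
        ∑ j, (t j - ⌊t j⌋₊) • dualVec n j := by
      rw [latticePoint, ← Finset.sum_add_distrib]
      simp only [← add_smul, add_sub_cancel]
      exact hHt
    rw [hsplit, expA_add, ← mul_assoc k₁, mul_assoc (k₁ * _)]
    refine Set.mul_mem_mul (Set.mul_mem_mul hk₁ rfl) (Set.mul_mem_mul ⟨_, ⟨_, ?_, rfl⟩, rfl⟩ hk₂)
    intro j _
    exact ⟨sub_nonneg.2 (hfl j), by linarith [Nat.lt_floor_add_one (t j)]⟩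

theorem exists_eval_le_mul_pow (p : Polynomial ℝ) :
    ∃ A : ℝ, 0 ≤ A ∧ ∀ x, 0 ≤ x → p.eval x ≤ A * (1 + x) ^ p.natDegree := by
  refine ⟨∑ i ∈ Finset.range (p.natDegree + 1), |p.coeff i|, by positivity, fun x hx => ?_⟩
  rw [Polynomial.eval_eq_sum_range, Finset.sum_mul]
  refine Finset.sum_le_sum fun i hi => ?_
  have h1 : x ^ i ≤ (1 + x) ^ p.natDegree :=
    (pow_le_pow_left₀ hx (by linarith) i).trans
      (pow_le_pow_right₀ (by linarith) (Nat.lt_succ_iff.1 (Finset.mem_range.1 hi)))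
  exact mul_le_mul (le_abs_self _) h1 (by positivity) (abs_nonneg _)

/-- On the shell of `m`, a bi-`K`-invariant function of the form `P e^{-θ}` is bounded by its size
at the lattice point. -/
theorem exists_abs_le_on_shell {n : ℕ} (θ : Module.Dual ℝ (Cartan n)) (P : Cartan n → ℝ)
    (p : Polynomial ℝ) (hP : ∀ H ∈ chamber n, |P H| ≤ p.eval ‖H‖) (F : G n → ℝ)
    (hFK : ∀ k₁ ∈ K n, ∀ k₂ ∈ K n, ∀ g, F (k₁ * g * k₂) = F g)
    (hF : ∀ H ∈ chamber n, F (expA H) = P H * Real.exp (-θ H)) :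
    ∃ A : ℝ, 0 ≤ A ∧ ∀ (m : Fin n → ℕ), ∀ g ∈ shell m,
      |F g| ≤ A * (1 + ∑ j, (m j : ℝ)) ^ p.natDegree * Real.exp (-θ (latticePoint m)) := by
  obtain ⟨A, hA, hp⟩ := exists_eval_le_mul_pow p
  set b : ℝ := ∑ j, ‖dualVec n j‖ with hb
  have hb0 : 0 ≤ b := Finset.sum_nonneg fun _ _ => norm_nonneg _
  refine ⟨A * (1 + b) ^ p.natDegree * Real.exp (∑ j, |θ (dualVec n j)|), by positivity, ?_⟩
  rintro m _ ⟨_, ⟨k₁, hk₁, _, rfl, rfl⟩, _, ⟨_, ⟨_, ⟨t, ht, rfl⟩, rfl⟩, k₂, hk₂, rfl⟩, rfl⟩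
  have ht' : ∀ j, 0 ≤ t j ∧ t j ≤ 1 := fun j => ht j (Set.mem_univ j)
  set H := latticePoint m + ∑ j, t j • dualVec n j with hH
  have hHsum : H = ∑ j, ((m j : ℝ) + t j) • dualVec n j := by
    simp only [hH, latticePoint, add_smul, Finset.sum_add_distrib]
  have hHmem : H ∈ chamber n := by
    rw [hHsum]
    exact sum_smul_dualVec_mem_chamber fun j => add_nonneg (Nat.cast_nonneg _) (ht' j).1
  have hFH : F (k₁ * expA (latticePoint m) * (expA (∑ j, t j • dualVec n j) * k₂)) =
      P H * Real.exp (-θ H) := by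
    rw [← hF H hHmem, ← hFK k₁ hk₁ k₂ hk₂ (expA H), hH, expA_add]
    simp only [mul_assoc]
  set M : ℝ := ∑ j, (m j : ℝ) with hM
  have hM0 : 0 ≤ M := Finset.sum_nonneg fun _ _ => Nat.cast_nonneg _
  have hnorm : ‖H‖ ≤ (1 + M) * b := by
    rw [hHsum, hb, Finset.mul_sum]
    refine (norm_sum_le _ _).trans (Finset.sum_le_sum fun j _ => ?_)
    rw [norm_smul, Real.norm_of_nonneg (add_nonneg (Nat.cast_nonneg _) (ht' j).1)]
    refine mul_le_mul_of_nonneg_right ?_ (norm_nonneg _)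
    have : (m j : ℝ) ≤ M :=
      Finset.single_le_sum (f := fun j => (m j : ℝ)) (fun _ _ => Nat.cast_nonneg _)
        (Finset.mem_univ j)
    linarith [(ht' j).2]
  have hPH : |P H| ≤ A * ((1 + b) ^ p.natDegree * (1 + M) ^ p.natDegree) := by
    refine (hP H hHmem).trans ((hp _ (norm_nonneg _)).trans ?_)
    rw [← mul_pow]
    refine mul_le_mul_of_nonneg_left (pow_le_pow_left₀ (by positivity) ?_ _) hA
    nlinarith
  have hθ : Real.exp (-θ H) ≤
      Real.exp (-θ (latticePoint m)) * Real.exp (∑ j, |θ (dualVec n j)|) := by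
    rw [← Real.exp_add, Real.exp_le_exp, hH, map_add, apply_sum_smul_dualVec]
    have : -∑ j, t j * θ (dualVec n j) ≤ ∑ j, |θ (dualVec n j)| := by
      rw [← Finset.sum_neg_distrib]
      refine Finset.sum_le_sum fun j _ => (neg_le_abs _).trans ?_
      rw [abs_mul, abs_of_nonneg (ht' j).1]
      exact mul_le_of_le_one_left (abs_nonneg _) (ht' j).2
    linarith
  change |F (k₁ * expA (latticePoint m) * (expA (∑ j, t j • dualVec n j) * k₂))| ≤ _
  rw [hFH, abs_mul, abs_of_pos (Real.exp_pos _)]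
  calc |P H| * Real.exp (-θ H)
      ≤ A * ((1 + b) ^ p.natDegree * (1 + M) ^ p.natDegree) *
        (Real.exp (-θ (latticePoint m)) * Real.exp (∑ j, |θ (dualVec n j)|)) := by gcongr
    _ = _ := by ring

theorem exists_setLIntegral_shell_le {n : ℕ} [MeasurableSpace (G n)] [BorelSpace (G n)]
    (vol : Measure (G n)) [vol.IsHaarMeasure]
    (θ : Module.Dual ℝ (Cartan n)) (P : Cartan n → ℝ)
    (p : Polynomial ℝ) (hP : ∀ H ∈ chamber n, |P H| ≤ p.eval ‖H‖) (F : G n → ℝ)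
    (hFK : ∀ k₁ ∈ K n, ∀ k₂ ∈ K n, ∀ g, F (k₁ * g * k₂) = F g)
    (hF : ∀ H ∈ chamber n, F (expA H) = P H * Real.exp (-θ H)) :
    ∃ A : ℝ, 0 ≤ A ∧ ∀ m : Fin n → ℕ, ∫⁻ g in shell m, ‖F g‖ₑ ∂vol ≤
      ENNReal.ofReal (A * (1 + ∑ j, (m j : ℝ)) ^ p.natDegree *
        Real.exp ((twoRho n - θ) (latticePoint m))) := by
  obtain ⟨A, hA, hbound⟩ := exists_abs_le_on_shell θ P p hP F hFK hF
  obtain ⟨C, hC, hvol⟩ := exists_measure_K_mul_expA_mul_le n vol (isCompact_expA_unitCell_mul_K n)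
  refine ⟨A * C, by positivity, fun m => ?_⟩
  have hM0 : 0 ≤ ∑ j, (m j : ℝ) := Finset.sum_nonneg fun _ _ => Nat.cast_nonneg _
  calc ∫⁻ g in shell m, ‖F g‖ₑ ∂vol
      ≤ ∫⁻ _ in shell m, ENNReal.ofReal (A * (1 + ∑ j, (m j : ℝ)) ^ p.natDegree *
          Real.exp (-θ (latticePoint m))) ∂vol := by
        refine setLIntegral_mono' (isCompact_shell m).measurableSet fun g hg => ?_
        rw [Real.enorm_eq_ofReal_abs]
        exact ENNReal.ofReal_le_ofReal (hbound m g hg)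
    _ ≤ ENNReal.ofReal (A * (1 + ∑ j, (m j : ℝ)) ^ p.natDegree *
          Real.exp (-θ (latticePoint m))) *
          ENNReal.ofReal (C * Real.exp (twoRho n (latticePoint m))) := by
        rw [setLIntegral_const]
        gcongr
        exact hvol _ (latticePoint_mem_chamber m)
    _ = _ := by
        rw [← ENNReal.ofReal_mul (by positivity)]
        congr 1
        rw [LinearMap.sub_apply, sub_eq_neg_add, Real.exp_add]
        ring

/-! ### The exponent -/

theorem mOnePrime_pos {n : ℕ} (hn : 1 ≤ n) {lam ψ : Module.Dual ℝ (Cartan n)}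
    (hlam : ∀ j, 0 < lam (dualVec n j)) (hψ : ∀ j, 0 < ψ (dualVec n j)) :
    0 < mOnePrime n lam ψ := by
  have : Nonempty (Fin n) := ⟨⟨0, hn⟩⟩
  obtain ⟨j, hj⟩ := exists_eq_ciInf_of_finite (f := fun j : Fin n =>
    lam (dualVec n j) / ψ (dualVec n j))
  rw [mOnePrime, ← hj]
  exact div_pos (hlam j) (hψ j)

theorem apply_latticePoint_le {n : ℕ} (hn : 1 ≤ n) {lam ψ : Module.Dual ℝ (Cartan n)}
    (hlam : ∀ j, 0 < lam (dualVec n j)) (hψ : ∀ j, 0 < ψ (dualVec n j)) (m : Fin n → ℕ) :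
    ψ (latticePoint m) ≤ (∑ j, (m j : ℝ) * lam (dualVec n j)) / mOnePrime n lam ψ := by
  rw [latticePoint, apply_sum_smul_dualVec, le_div_iff₀ (mOnePrime_pos hn hlam hψ), Finset.sum_mul]
  refine Finset.sum_le_sum fun j _ => ?_
  have h : mOnePrime n lam ψ ≤ lam (dualVec n j) / ψ (dualVec n j) :=
    ciInf_le (Set.finite_range _).bddBelow j
  rw [le_div_iff₀ (hψ j), mul_comm] at h
  rw [mul_assoc]
  exact mul_le_mul_of_nonneg_left h (Nat.cast_nonneg _)

end SLBalls

theorem mainTheorem7 (n N : ℕ) (hn : 1 ≤ n)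
    [MeasurableSpace (SLBalls.G n)] [BorelSpace (SLBalls.G n)]
    (vol : Measure (SLBalls.G n)) [vol.IsHaarMeasure]
    (τ : SLBalls.G n →* GL (Fin N) ℝ) (hτcont : Continuous τ) (hτnontriv : τ ≠ 1)
    (hτirr : (SLBalls.linRep τ).IsIrreducible)
    (hτK : ∀ k ∈ SLBalls.K n,
      (τ k : Matrix (Fin N) (Fin N) ℝ) ∈ Matrix.specialOrthogonalGroup (Fin N) ℝ)
    (lam : Module.Dual ℝ (SLBalls.Cartan n)) (hlam : SLBalls.IsHighestWeight τ lam)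
    (θ : Module.Dual ℝ (SLBalls.Cartan n))
    (hψ : ∀ j : Fin n, 0 < (SLBalls.twoRho n - θ) (SLBalls.dualVec n j))
    (P : SLBalls.Cartan n → ℝ) (p : Polynomial ℝ)
    (hP : ∀ H ∈ SLBalls.chamber n, |P H| ≤ p.eval ‖H‖)
    (F : SLBalls.G n → ℝ) (hFmeas : AEStronglyMeasurable F vol)
    (hFK : ∀ k₁ ∈ SLBalls.K n, ∀ k₂ ∈ SLBalls.K n, ∀ g, F (k₁ * g * k₂) = F g)
    (hF : ∀ H ∈ SLBalls.chamber n, F (SLBalls.expA H) = P H * Real.exp (-θ H)) :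
    ∃ (l' : ℕ) (C : ℝ), 0 < C ∧ ∀ T : ℝ, 1 < T →
      IntegrableOn F (SLBalls.ball τ T) vol ∧
        ∫ g in SLBalls.ball τ T, F g ∂vol ≤
          C * Real.log T ^ l' * T ^ (1 / SLBalls.mOnePrime n lam (SLBalls.twoRho n - θ)) := by
  have hpos := hlam.apply_dualVec_pos hn hτcont hτnontriv hτirr
  have hm := SLBalls.mOnePrime_pos hn hpos hψ
  obtain ⟨A, hA, hshell⟩ := SLBalls.exists_setLIntegral_shell_le vol θ P p hP F hFK hF
  have : Nonempty (Fin n) := ⟨⟨0, hn⟩⟩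
  obtain ⟨j₀, hj₀⟩ := Finite.exists_min fun j => lam (SLBalls.dualVec n j)
  set κ := lam (SLBalls.dualVec n j₀) with hκdef
  have hκ : 0 < κ := hpos j₀
  set L₀ := Real.log (Real.sqrt 2) with hL₀def
  have hL₀ : 0 < L₀ := Real.log_pos (Real.lt_sqrt_of_sq_lt (by norm_num))
  set μ := SLBalls.mOnePrime n lam (SLBalls.twoRho n - θ) with hμdef
  refine ⟨n + p.natDegree, A * (1 / L₀ + 1 / κ) ^ (n + p.natDegree) + 1, by positivity,
    fun T hT => ?_⟩
  have hT0 : 0 < T := by linarith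
  have hlogT : 0 < Real.log T := Real.log_pos hT
  -- every `τ(g)` has determinant `1`, so small balls are empty although `log T` tends to zero
  rcases lt_or_ge T (Real.sqrt 2) with hTs | hTs
  · have hempty : SLBalls.ball τ T = ∅ := by
      ext g
      simp only [Set.mem_empty_iff_false, iff_false]
      intro hg
      have hg : SLBalls.normTau τ g ≤ T := hg
      linarith [SLBalls.sqrt_two_le_normTau hn τ hτnontriv g]
    rw [hempty]
    refine ⟨integrableOn_empty, ?_⟩
    rw [setIntegral_empty]
    positivity
  set L := Real.log T with hLdef
  have hLL₀ : L₀ ≤ L := Real.log_le_log (by positivity) hTs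
  set I : Finset (Fin n → ℕ) := (Fintype.piFinset fun _ => Finset.range (⌊L / κ⌋₊ + 1)).filter
    fun m => ∑ j, (m j : ℝ) * lam (SLBalls.dualVec n j) ≤ L with hI
  have hsumle : ∀ m : Fin n → ℕ, ∑ j, (m j : ℝ) * lam (SLBalls.dualVec n j) ≤ L →
      ∑ j, (m j : ℝ) ≤ L / κ := by
    intro m hmL
    rw [le_div_iff₀ hκ, Finset.sum_mul]
    exact (Finset.sum_le_sum fun j _ =>
      mul_le_mul_of_nonneg_left (hj₀ j) (Nat.cast_nonneg _)).trans hmL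
  have hcover : SLBalls.ball τ T ⊆ ⋃ m ∈ I, SLBalls.shell m := by
    intro g hg
    obtain ⟨m, hmL, hgm⟩ := SLBalls.exists_mem_shell_of_mem_ball hτK hlam.1 hpos hg
    refine Set.mem_iUnion₂.2 ⟨m, ?_, hgm⟩
    rw [hI, Finset.mem_filter, Fintype.mem_piFinset]
    refine ⟨fun j => Finset.mem_range.2 (Nat.lt_succ_of_le (Nat.le_floor ?_)), hmL⟩
    exact (Finset.single_le_sum (f := fun j => (m j : ℝ)) (fun _ _ => Nat.cast_nonneg _)
      (Finset.mem_univ j)).trans (hsumle m hmL)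
  have hcard : (I.card : ℝ) ≤ (1 + L / κ) ^ n := by
    have h1 : I.card ≤ (⌊L / κ⌋₊ + 1) ^ n := by
      refine (Finset.card_filter_le _ _).trans (le_of_eq ?_)
      simp
    calc (I.card : ℝ) ≤ ((⌊L / κ⌋₊ : ℝ) + 1) ^ n := by exact_mod_cast h1
      _ ≤ _ := by
        refine pow_le_pow_left₀ (by positivity) ?_ n
        linarith [Nat.floor_le (show 0 ≤ L / κ by positivity)]
  have hterm : ∀ m ∈ I, A * (1 + ∑ j, (m j : ℝ)) ^ p.natDegree *
      Real.exp ((SLBalls.twoRho n - θ) (SLBalls.latticePoint m)) ≤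
        A * (1 + L / κ) ^ p.natDegree * Real.exp (L / μ) := by
    intro m hmI
    have hmL := (Finset.mem_filter.1 hmI).2
    have h1 := hsumle m hmL
    have h2 : (SLBalls.twoRho n - θ) (SLBalls.latticePoint m) ≤ L / μ :=
      (SLBalls.apply_latticePoint_le hn hpos hψ m).trans (div_le_div_of_nonneg_right hmL hm.le)
    have h3 : 0 ≤ ∑ j, (m j : ℝ) := Finset.sum_nonneg fun _ _ => Nat.cast_nonneg _
    gcongr
  have hexp : Real.exp (L / μ) = T ^ (1 / μ) := by
    rw [Real.rpow_def_of_pos hT0, ← hLdef]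
    congr 1
    ring
  have hlin : 1 + L / κ ≤ (1 / L₀ + 1 / κ) * L := by
    have : 1 ≤ L / L₀ := (one_le_div hL₀).2 hLL₀
    calc 1 + L / κ ≤ L / L₀ + L / κ := by linarith
      _ = _ := by ring
  have htotal : ∫⁻ g in SLBalls.ball τ T, ‖F g‖ₑ ∂vol ≤ ENNReal.ofReal
      ((A * (1 / L₀ + 1 / κ) ^ (n + p.natDegree) + 1) * L ^ (n + p.natDegree) * T ^ (1 / μ)) := by
    calc ∫⁻ g in SLBalls.ball τ T, ‖F g‖ₑ ∂vol
        ≤ ∑ m ∈ I, ∫⁻ g in SLBalls.shell m, ‖F g‖ₑ ∂vol := by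
          refine (lintegral_mono_set hcover).trans ?_
          rw [← Finset.tsum_subtype I fun m => ∫⁻ g in SLBalls.shell m, ‖F g‖ₑ ∂vol,
            show ⋃ m ∈ I, SLBalls.shell m = ⋃ m : I, SLBalls.shell m.1 by ext; simp]
          exact lintegral_iUnion_le _ _
      _ ≤ ∑ _m ∈ I, ENNReal.ofReal (A * (1 + L / κ) ^ p.natDegree * Real.exp (L / μ)) :=
          Finset.sum_le_sum fun m hmI =>
            (hshell m).trans (ENNReal.ofReal_le_ofReal (hterm m hmI))
      _ = ENNReal.ofReal (I.card * (A * (1 + L / κ) ^ p.natDegree * Real.exp (L / μ))) := by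
          rw [Finset.sum_const, nsmul_eq_mul, ENNReal.ofReal_mul (Nat.cast_nonneg _),
            ENNReal.ofReal_natCast]
      _ ≤ _ := by
          refine ENNReal.ofReal_le_ofReal ?_
          calc I.card * (A * (1 + L / κ) ^ p.natDegree * Real.exp (L / μ))
              ≤ (1 + L / κ) ^ n * (A * (1 + L / κ) ^ p.natDegree * Real.exp (L / μ)) := by
                gcongr
            _ = A * (1 + L / κ) ^ (n + p.natDegree) * T ^ (1 / μ) := by
                rw [hexp, pow_add]; ring
            _ ≤ A * ((1 / L₀ + 1 / κ) * L) ^ (n + p.natDegree) * T ^ (1 / μ) := by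
                gcongr
            _ = A * (1 / L₀ + 1 / κ) ^ (n + p.natDegree) * L ^ (n + p.natDegree) *
                  T ^ (1 / μ) := by rw [mul_pow]; ring
            _ ≤ _ := by
                gcongr
                linarith
  have hint : IntegrableOn F (SLBalls.ball τ T) vol :=
    ⟨hFmeas.restrict, htotal.trans_lt ENNReal.ofReal_lt_top⟩
  refine ⟨hint, ?_⟩
  have h1 : ‖∫ g in SLBalls.ball τ T, F g ∂vol‖ₑ ≤ _ :=
    (enorm_integral_le_lintegral_enorm F).trans htotal
  rw [Real.enorm_eq_ofReal_abs, ENNReal.ofReal_le_ofReal_iff (by positivity)] at h1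
  exact (le_abs_self _).trans h1
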